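/- Let $d\ge 1$, and let $h\in C^1(0,\infty)$ be a Synge-type equation of state, i.e. with $e(\theta):=h(\theta)-\theta-1$ one has $1+e(\theta)=h(\theta)-\theta>0$ and the causality condition $$h'(\theta)>\frac{h(\theta)}{h(\theta)-\theta}\qquad\text{for all }\theta>0 .$$ For $\rho>0$, $p>0$, $\mathbf v\in\mathbb R^d$, $|\mathbf v|<1$, put $\gamma=(1-|\mathbf v|^2)^{-1/2}$, $\theta=p/\rho$ and $$\mathbf U=(D,\mathbf m,E)=(\rho\gamma,\ \rho h(\theta)\gamma^2\mathbf v,\ \rho h(\theta)\gamma^2-p),\qquad \mathbf F_i(\mathbf U)=(Dv_i,\ v_i\mathbf m+p\,\mathbf e_i,\ m_i),$$ let $\mathcal G$ be the set of all such $\mathbf U$, and let $$S(\mathbf U)=-\ln\rho+\int_1^{\theta}\frac{e'(\xi)}{\xi}\,d\xi .$$ A convex entropy pair is a pair $(\eta,q)$ of $C^1$ functions $\eta:\mathcal G\to\mathbb R$, $q=(q_1,\dots,q_d):\mathcal G\to\mathbb R^d$ with $\eta$ convex and $\nabla q_i=\nabla\eta\,\partial\mathbf F_i/\partial\mathbf U$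 for all $i$. An entropy solution on $\mathbb R^d\times[0,T)$ is a field $\mathbf U(\mathbf x,t)$ with initial datum $\mathbf U(\cdot,0)$, both with values in $\mathcal G$ almost everywhere, such that $\mathbf U$, $\mathbf U(\cdot,0)$ and $\mathbf F_i(\mathbf U)$ are locally integrable (up to $t=0$), the special relativistic Euler system $\partial_t\mathbf U+\sum_{i=1}^d\partial_{x_i}\mathbf F_i(\mathbf U)=0$ holds in the sense of distributions with this initial datum, and, for every convex entropy pair $(\eta,q)$, the functions $\eta(\mathbf U)$, $q_i(\mathbf U)$, $\eta(\mathbf U(\cdot,0))$ are locally integrable and $$\int_0^T\!\!\int_{\mathbb R^d}\Big(\eta(\mathbf U)\,\partial_t\varphi+\sum_{i=1}^d q_i(\mathbf U)\,\partial_{x_i}\varphi\Big)d\mathbf x\,dt+\int_{\mathbb R^d}\eta(\mathbf U(\mathbf x,0))\,\varphi(\mathbf x,0)\,d\mathbf x\ \ge 0$$ for all smooth $\varphi\ge 0$ with compact support in $\mathbb R^d\times(-\infty,T)$. **Theorem.** Let $\mathbf U$ be an entropy solution on $\mathbb R^d\times[0,T)$, and let $v_{\max}$ be its maximal wave speed,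 i.e. the essential supremum over $\mathbb R^d\times(0,T)$ of $|\lambda|$ over all real eigenvalues $\lambda$ of the matrices $\sum_i n_i\,\partial\mathbf F_i/\partial\mathbf U(\mathbf U(\mathbf x,t))$, $|\mathbf n|=1$ (or any larger number). Then the specific entropy satisfies the local minimum entropy principle: there is a Lebesgue-null set $N$ of times with $0\notin N$ such that, for all $0<\tau\le t<T$ with $t\notin N$ and $t-\tau\notin N$, $$S(\mathbf x,t)\ \ge\ \operatorname*{ess\,inf}_{|\mathbf z-\mathbf x|\le\tau v_{\max}}S(\mathbf z,t-\tau)\qquad\text{for almost every }\mathbf x\in\mathbb R^d ,$$ where $S(\mathbf x,t)=S(\mathbf U(\mathbf x,t))$. If, moreover, $t\mapsto\mathbf U(\cdot,t)$ is continuous from $[0,T)$ to $L^1_{\rm loc}(\mathbb R^d)$ and, for each $t_0<T$ and $R>0$, there is a compact subset of $\mathcal G$ that contains $\mathbf U(\mathbf x,t)$ for all $t\in[0,t_0]$ and almost every $|\mathbf x|<R$, then this inequality holds for all $0<\tau\le t<T$. -/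

import Mathlib

open Real Set Filter Topology MeasureTheory
open scoped ContDiff

noncomputable section

namespace RelEuler

/-- Physical space `ℝ^d` with the Euclidean norm. -/
abbrev Space (d : ℕ) : Type := EuclideanSpace ℝ (Fin d)

/-- Conservative variables `(D, m, E)`. -/
abbrev State (d : ℕ) : Type := ℝ × Space d × ℝ

/-- Primitive variables `(ρ, v, p)`. -/
abbrev Prim (d : ℕ) : Type := ℝ × Space d × ℝ

/-- The specific internal energy `e(θ) = h(θ) - θ - 1` of the equation of state `h`. -/
def internalEnergy (h : ℝ → ℝ) (θ : ℝ) : ℝ := h θ - θ - 1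

/-- A Synge-type equation of state `h = h(θ)`: continuously differentiable on `(0, ∞)`, with
`h - θ = 1 + e > 0`, and satisfying the causality condition `h' > h / (h - θ)`. -/
structure IsSyngeEOS (h : ℝ → ℝ) : Prop where
  contDiffOn : ContDiffOn ℝ 1 h (Ioi 0)
  pos : ∀ θ : ℝ, 0 < θ → θ < h θ
  causal : ∀ θ : ℝ, 0 < θ → h θ / (h θ - θ) < deriv h θ

/-- The Lorentz factor (speed of light `1`). -/
def lorentz {d : ℕ} (v : Space d) : ℝ := (√(1 - ‖v‖ ^ 2))⁻¹

/-- Physically admissible primitive states: `ρ > 0`, `p > 0`, `|v| < 1`. -/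
def physPrim (d : ℕ) : Set (Prim d) := {V | 0 < V.1 ∧ 0 < V.2.2 ∧ ‖V.2.1‖ < 1}

/-- The conservative vector `U = (ργ, ρhγ² v, ρhγ² - p)` of a primitive state, `h = h(p/ρ)`. -/
def toCons {d : ℕ} (h : ℝ → ℝ) (V : Prim d) : State d :=
  (V.1 * lorentz V.2.1,
   (V.1 * h (V.2.2 / V.1) * lorentz V.2.1 ^ 2) • V.2.1,
   V.1 * h (V.2.2 / V.1) * lorentz V.2.1 ^ 2 - V.2.2)

/-- The set of physically admissible conservative states. -/
def admissible (d : ℕ) (h : ℝ → ℝ) : Set (State d) := toCons h '' physPrim d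

/-- The primitive variables of an admissible conservative state. -/
def toPrim {d : ℕ} (h : ℝ → ℝ) : State d → Prim d :=
  Function.invFunOn (toCons h) (physPrim d)

/-- Rest-mass density `ρ(U)`. -/
def density {d : ℕ} (h : ℝ → ℝ) (u : State d) : ℝ := (toPrim h u).1

/-- The velocity `v(U)`. -/
def velocity {d : ℕ} (h : ℝ → ℝ) (u : State d) : Space d := (toPrim h u).2.1

/-- The pressure `p(U)`. -/
def pressure {d : ℕ} (h : ℝ → ℝ) (u : State d) : ℝ := (toPrim h u).2.2

/-- The temperature-like variable `θ = p/ρ`. -/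
def theta {d : ℕ} (h : ℝ → ℝ) (u : State d) : ℝ := pressure h u / density h u

/-- The flux `F_i(U) = (D v_i, v_i m + p e_i, m_i)`. -/
def flux {d : ℕ} (h : ℝ → ℝ) (i : Fin d) (u : State d) : State d :=
  (u.1 * velocity h u i,
   velocity h u i • u.2.1 + pressure h u • EuclideanSpace.single i (1 : ℝ),
   u.2.1 i)

/-- The specific entropy `S(U) = -ln ρ + ∫_1^θ e'(ξ)/ξ dξ`. -/
def specificEntropy {d : ℕ} (h : ℝ → ℝ) (u : State d) : ℝ :=
  -Real.log (density h u) + ∫ ξ in (1 : ℝ)..(theta h u), deriv (internalEnergy h) ξ / ξ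

/-- `(η, q)` is a convex entropy pair of the system: `η` and `q = (q_1, …, q_d)` are `C¹`
functions on the admissible set, `η` is convex there, and `∇q_i = ∇η · ∂F_i/∂U`. -/
structure IsConvexEntropyPair {d : ℕ} (h : ℝ → ℝ) (η : State d → ℝ)
    (q : Fin d → State d → ℝ) : Prop where
  contDiffOn_entropy : ContDiffOn ℝ 1 η (admissible d h)
  contDiffOn_flux : ∀ i, ContDiffOn ℝ 1 (q i) (admissible d h)
  convexOn : ConvexOn ℝ (admissible d h) η
  compatible : ∀ i, ∀ u ∈ admissible d h,
    fderiv ℝ (q i) u = (fderiv ℝ η u).comp (fderiv ℝ (flux h i) u)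

/-- Time derivative of a test function of `(t, x)`. -/
def dt {d : ℕ} (φ : ℝ × Space d → ℝ) (z : ℝ × Space d) : ℝ := fderiv ℝ φ z (1, 0)

/-- The `i`-th spatial derivative of a test function of `(t, x)`. -/
def dx {d : ℕ} (i : Fin d) (φ : ℝ × Space d → ℝ) (z : ℝ × Space d) : ℝ :=
  fderiv ℝ φ z (0, EuclideanSpace.single i (1 : ℝ))

/-- Smooth test functions with compact support in `(-∞, T) × ℝ^d`
(they need not vanish at the initial time `0`). -/
structure IsTestFunction {d : ℕ} (T : ℝ) (φ : ℝ × Space d → ℝ) : Prop where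
  smooth : ContDiff ℝ ∞ φ
  compact : HasCompactSupport φ
  support : tsupport φ ⊆ Iio T ×ˢ univ

/-- The open space-time strip `(0, T) × ℝ^d`. -/
def strip (d : ℕ) (T : ℝ) : Set (ℝ × Space d) := Ioo 0 T ×ˢ univ

/-- Local integrability of a field on `[0, T) × ℝ^d` (up to the initial time), together with
local integrability on `ℝ^d` of its value at time `0`. -/
def LocInt {d : ℕ} {F : Type} [NormedAddCommGroup F] (T : ℝ) (f : ℝ → Space d → F) : Prop :=
  LocallyIntegrableOn (fun z : ℝ × Space d => f z.1 z.2) (Ico 0 T ×ˢ univ) volume ∧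
    LocallyIntegrable (f 0) volume

/-- `U` is an entropy solution on `[0, T) × ℝ^d` with initial datum `U 0`: its values are
admissible almost everywhere, it solves the system in the sense of distributions, and for every
convex entropy pair `(η, q)` the functions `η(U)`, `q(U)` are locally integrable and
`∂_t η(U) + ∑ ∂_i q_i(U) ≤ 0` in the sense of distributions, initial datum included. -/
structure IsEntropySolution {d : ℕ} (h : ℝ → ℝ) (T : ℝ) (U : ℝ → Space d → State d) : Prop where
  mem : ∀ᵐ z : ℝ × Space d ∂(volume.restrict (strip d T)), U z.1 z.2 ∈ admissible d h
  mem_init : ∀ᵐ x : Space d, U 0 x ∈ admissible d h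
  locInt : LocInt T U
  locInt_flux : ∀ i, LocallyIntegrableOn (fun z : ℝ × Space d => flux h i (U z.1 z.2))
    (Ico 0 T ×ˢ univ) volume
  weak : ∀ φ : ℝ × Space d → ℝ, IsTestFunction T φ →
    (∫ z in strip d T, (dt φ z • U z.1 z.2 + ∑ i, dx i φ z • flux h i (U z.1 z.2)))
      + ∫ x : Space d, φ (0, x) • U 0 x = 0
  entropy : ∀ (η : State d → ℝ) (q : Fin d → State d → ℝ), IsConvexEntropyPair h η q →
    LocInt T (fun t x => η (U t x)) ∧
    (∀ i, LocallyIntegrableOn (fun z : ℝ × Space d => q i (U z.1 z.2))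
      (Ico 0 T ×ˢ univ) volume) ∧
    ∀ φ : ℝ × Space d → ℝ, IsTestFunction T φ → (∀ z, 0 ≤ φ z) →
      0 ≤ (∫ z in strip d T, (dt φ z * η (U z.1 z.2) + ∑ i, dx i φ z * q i (U z.1 z.2)))
        + ∫ x : Space d, φ (0, x) * η (U 0 x)

/-- `c` is a characteristic speed of the system at the state `u`: an eigenvalue of
`∑ n_i ∂F_i/∂U` for some unit vector `n`. -/
def IsCharSpeed {d : ℕ} (h : ℝ → ℝ) (u : State d) (c : ℝ) : Prop :=
  ∃ n : Space d, ‖n‖ = 1 ∧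
    Module.End.HasEigenvalue
      ((∑ i, n i • fderiv ℝ (flux h i) u : State d →L[ℝ] State d) : Module.End ℝ (State d)) c

/-- `vmax` is an (essential) upper bound of all characteristic speeds of `U` in the space-time
domain; the least such number is the maximal wave speed. -/
def BoundsWaveSpeed {d : ℕ} (h : ℝ → ℝ) (T : ℝ) (U : ℝ → Space d → State d) (vmax : ℝ) : Prop :=
  ∀ᵐ z : ℝ × Space d ∂(volume.restrict (strip d T)),
    ∀ c : ℝ, IsCharSpeed h (U z.1 z.2) c → |c| ≤ vmax

/-- `U` is continuous in time with values in `L¹_loc`, and locally in space-time it stays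
(for every time) in a compact set of admissible states. -/
structure IsTimeContinuous {d : ℕ} (h : ℝ → ℝ) (T : ℝ) (U : ℝ → Space d → State d) : Prop where
  aesm : ∀ t ∈ Ico 0 T, AEStronglyMeasurable (U t) volume
  compact : ∀ t₀ ∈ Ico 0 T, ∀ R : ℝ, ∃ K : Set (State d), IsCompact K ∧ K ⊆ admissible d h ∧
    ∀ t ∈ Icc 0 t₀, ∀ᵐ x ∂(volume.restrict (Metric.ball (0 : Space d) R)), U t x ∈ K
  continuous : ∀ t₀ ∈ Ico 0 T, ∀ R : ℝ,
    Tendsto (fun t => ∫⁻ x in Metric.ball (0 : Space d) R, ‖U t x - U t₀ x‖ₑ)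
      (𝓝[Ico 0 T] t₀) (𝓝 0)

/-- The local minimum entropy principle between the times `t - τ` and `t`: for almost every `x`,
`S(x, t) ≥ ess inf { S(z, t - τ) : |z - x| ≤ τ vmax }` (essential infimum in `[-∞, ∞]`). -/
def LocalMEP {d : ℕ} (h : ℝ → ℝ) (U : ℝ → Space d → State d) (vmax t τ : ℝ) : Prop :=
  ∀ᵐ x : Space d,
    essInf (fun z : Space d => ((specificEntropy h (U (t - τ) z) : ℝ) : EReal))
        (volume.restrict (Metric.closedBall x (τ * vmax)))
      ≤ ((specificEntropy h (U t x) : ℝ) : EReal)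

end RelEuler

end

/-!
Every function `η = D φ(S)` with `φ` of class `C¹`, convex and nonincreasing, is a convex entropy
with flux `q = η v`. Indeed `D S` is a concave function of the conservative variables, and `η` is
the perspective `(D, σ) ↦ D φ(σ / D)` of `φ`, composed with the concave function `σ = D S`. Taking
`φ(s) = ((s₀ - s)⁺)²` gives a nonnegative entropy that vanishes exactly where `S ≥ s₀`
(`isConvexEntropyPair_cutEntropy`). As `|v|` is a characteristic speed, `|v| ≤ vmax`, and the amount
of `η` in a backward light cone of speed `vmax` cannot increase. If `S ≥ s₀` almost everywhere on
the base of a cone at the time `t - τ`, then `η` vanishes in the whole cone, i.e. `S ≥ s₀` there.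

Concavity of `D S` comes from the strict inequality between its graph and its tangent planes,
`entropy_tangent_lt`. After division by a positive factor the difference of the two sides is a sum
of three nonnegative terms, of which the essential one, `IsSyngeEOS.gibbs_nonneg`, depends only on
two temperatures and on the ratio of two Lorentz factors; its positivity is the causality condition
in the form "`(h - θ)² - θ²` increases". The same strict inequality shows that the map from
primitive to conservative variables is injective, and causality makes its Jacobian nonsingular
(`fderiv_toCons_injective`), so that all quantities are `C¹` on the open set of admissible states.
That set is convex because it is given by `D > 0`, `E > √((aD)² + |m|²)` with `a = inf (h - θ)`
(`mem_admissible_iff`).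

The entropy inequality, tested with products of a function of time and a smooth weight supported in
a cone, gives a distributional inequality for the entropy in the cone as a function of time
(`coneEntropy_distributional`). Mollification in time turns it into a pointwise inequality outside a
null set of times (`exists_null_forall_le_of_distributional`); countably many cones suffice, so one
null set serves all times. For solutions that are continuous in time the entropy in a cone converges
along suitable sequences of times, and no exceptional times remain.

The bases of these cones are larger than the closed balls of radius `τ vmax` in the theorem. The
loss is compensated in `localMEP_of_coneEntropy_le` at a density point of the set where the principle
would fail: near such a point the union of the balls of radius `τ vmax` about points of the set
contains a ball of larger radius. This needs `vmax > 0`, since for `vmax = 0` the essential infimum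
is over a null set, hence `+∞`; the strict inequality holds because the speed of sound in a fluid at
rest is a positive characteristic speed (`exists_isCharSpeed_pos`).
-/

/-! ### The equation of state -/

namespace RelEuler

noncomputable section

/-- The temperature part `∫_1^θ e'(ξ)/ξ dξ` of the specific entropy. -/
def thermalEntropy (h : ℝ → ℝ) (θ : ℝ) : ℝ :=
  ∫ ξ in (1 : ℝ)..θ, deriv (internalEnergy h) ξ / ξ

namespace IsSyngeEOS

variable {h : ℝ → ℝ}

lemma hasDerivAt (hh : IsSyngeEOS h) {θ : ℝ} (hθ : 0 < θ) : HasDerivAt h (deriv h θ) θ :=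
  ((hh.contDiffOn.contDiffAt (Ioi_mem_nhds hθ)).differentiableAt one_ne_zero).hasDerivAt

lemma hasDerivAt_internalEnergy (hh : IsSyngeEOS h) {θ : ℝ} (hθ : 0 < θ) :
    HasDerivAt (internalEnergy h) (deriv h θ - 1) θ :=
  ((hh.hasDerivAt hθ).sub (hasDerivAt_id' θ)).sub_const 1

lemma continuousOn_deriv (hh : IsSyngeEOS h) : ContinuousOn (deriv h) (Ioi 0) :=
  hh.contDiffOn.continuousOn_deriv_of_isOpen isOpen_Ioi le_rfl

lemma continuousOn_thermal_integrand (hh : IsSyngeEOS h) :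
    ContinuousOn (fun ξ => deriv (internalEnergy h) ξ / ξ) (Ioi 0) := by
  have h1 : ContinuousOn (fun ξ => (deriv h ξ - 1) / ξ) (Ioi 0) :=
    (hh.continuousOn_deriv.sub continuousOn_const).div continuousOn_id fun x hx => ne_of_gt hx
  exact h1.congr fun x hx => by simp [(hh.hasDerivAt_internalEnergy hx).deriv]

lemma hasDerivAt_thermalEntropy (hh : IsSyngeEOS h) {θ : ℝ} (hθ : 0 < θ) :
    HasDerivAt (thermalEntropy h) ((deriv h θ - 1) / θ) θ := by
  have hc := hh.continuousOn_thermal_integrand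
  have hsub : uIcc 1 θ ⊆ Ioi (0 : ℝ) := fun x hx =>
    lt_of_lt_of_le (lt_min one_pos hθ) hx.1
  have := intervalIntegral.integral_hasDerivAt_right (a := 1) (b := θ)
    ((hc.mono hsub).intervalIntegrable)
    (hc.stronglyMeasurableAtFilter isOpen_Ioi θ hθ) (hc.continuousAt (Ioi_mem_nhds hθ))
  rw [(hh.hasDerivAt_internalEnergy hθ).deriv] at this
  exact this

lemma contDiffOn_thermalEntropy (hh : IsSyngeEOS h) : ContDiffOn ℝ 1 (thermalEntropy h) (Ioi 0) := by
  have h1 : ContDiffOn ℝ (0 + 1) (thermalEntropy h) (Ioi 0) := by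
    rw [contDiffOn_succ_iff_deriv_of_isOpen isOpen_Ioi]
    refine ⟨fun x hx => (hh.hasDerivAt_thermalEntropy hx).differentiableAt.differentiableWithinAt,
      by simp, ?_⟩
    rw [contDiffOn_zero]
    refine ContinuousOn.congr (f := fun ξ => (deriv h ξ - 1) / ξ)
      ((hh.continuousOn_deriv.sub continuousOn_const).div continuousOn_id fun x hx => ne_of_gt hx) ?_
    exact fun x hx => (hh.hasDerivAt_thermalEntropy hx).deriv
  simpa using h1

/-- The causality condition in terms of the energy `h - θ` per unit rest mass. -/
lemma lt_energy_mul_deriv (hh : IsSyngeEOS h) {θ : ℝ} (hθ : 0 < θ) :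
    θ < (h θ - θ) * (deriv h θ - 1) := by
  have h1 := hh.causal θ hθ
  have h2 := hh.pos θ hθ
  rw [div_lt_iff₀ (by linarith)] at h1
  linarith

lemma one_lt_deriv (hh : IsSyngeEOS h) {θ : ℝ} (hθ : 0 < θ) : 1 < deriv h θ := by
  have h1 := hh.lt_energy_mul_deriv hθ
  have h2 := hh.pos θ hθ
  by_contra hc
  nlinarith

lemma continuousOn (hh : IsSyngeEOS h) : ContinuousOn h (Ioi 0) := hh.contDiffOn.continuousOn

lemma strictMonoOn_energy (hh : IsSyngeEOS h) : StrictMonoOn (fun θ => h θ - θ) (Ioi 0) := by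
  refine strictMonoOn_of_deriv_pos (convex_Ioi 0) (hh.continuousOn.sub continuousOn_id) ?_
  intro x hx
  rw [interior_Ioi] at hx
  rw [((hh.hasDerivAt hx).fun_sub (hasDerivAt_id' x)).deriv]
  linarith [hh.one_lt_deriv hx]

/-- Causality says exactly that `(h - θ)² - θ²` increases. -/
lemma strictMonoOn_energy_sq_sub_sq (hh : IsSyngeEOS h) :
    StrictMonoOn (fun θ => (h θ - θ) ^ 2 - θ ^ 2) (Ioi 0) := by
  refine strictMonoOn_of_deriv_pos (convex_Ioi 0)
    (((hh.continuousOn.sub continuousOn_id).pow 2).sub (continuousOn_id.pow 2)) ?_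
  intro x hx
  rw [interior_Ioi] at hx
  have hd := (((hh.hasDerivAt hx).fun_sub (hasDerivAt_id' x)).fun_pow 2).fun_sub
    ((hasDerivAt_id' x).fun_pow 2)
  rw [hd.deriv]
  have := hh.lt_energy_mul_deriv hx
  norm_num
  nlinarith

/-- The infimum of the energy per unit rest mass, i.e. its limit at zero temperature. -/
def _root_.RelEuler.restEnergy (h : ℝ → ℝ) : ℝ := sInf ((fun θ => h θ - θ) '' Ioi 0)

lemma restEnergy_nonneg (hh : IsSyngeEOS h) : 0 ≤ restEnergy h :=
  le_csInf (nonempty_Ioi.image _) (by rintro _ ⟨x, hx, rfl⟩; have := hh.pos x hx; dsimp only; linarith)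

lemma tendsto_energy (hh : IsSyngeEOS h) :
    Tendsto (fun θ => h θ - θ) (𝓝[>] 0) (𝓝 (restEnergy h)) :=
  hh.strictMonoOn_energy.monotoneOn.tendsto_nhdsGT
    ⟨0, by rintro _ ⟨x, hx, rfl⟩; have := hh.pos x hx; dsimp only; linarith⟩

lemma restEnergy_sq_le (hh : IsSyngeEOS h) {θ : ℝ} (hθ : 0 < θ) :
    restEnergy h ^ 2 ≤ (h θ - θ) ^ 2 - θ ^ 2 := by
  have ht : Tendsto (fun θ => (h θ - θ) ^ 2 - θ ^ 2) (𝓝[>] 0) (𝓝 (restEnergy h ^ 2 - 0 ^ 2)) :=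
    (hh.tendsto_energy.pow 2).sub ((tendsto_id.mono_left nhdsWithin_le_nhds).pow 2)
  rw [zero_pow two_ne_zero, sub_zero] at ht
  refine le_of_tendsto ht ?_
  filter_upwards [Ioo_mem_nhdsGT hθ] with x hx
  exact (hh.strictMonoOn_energy_sq_sub_sq hx.1 hθ hx.2).le

lemma lt_energy (hh : IsSyngeEOS h) {θ : ℝ} (hθ : 0 < θ) : θ < h θ - θ := by
  -- strictness comes from comparing with the temperature `θ / 2`
  have h1 := hh.strictMonoOn_energy_sq_sub_sq (half_pos hθ) hθ (by linarith)
  have h2 := hh.restEnergy_sq_le (half_pos hθ)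
  have h3 := hh.pos θ hθ
  have h4 : θ ^ 2 < (h θ - θ) ^ 2 := by
    have := sq_nonneg (restEnergy h)
    dsimp only at h1
    linarith
  exact lt_of_pow_lt_pow_left₀ 2 (by linarith) h4

/-- The minimum over the Lorentz ratio `r` of the expression in `IsSyngeEOS.gibbs_nonneg`, as a
function of the temperature `ξ` and up to a constant, the temperature `θ` being fixed. -/
def _root_.RelEuler.gibbsMin (h : ℝ → ℝ) (θ ξ : ℝ) : ℝ :=
  √((h ξ - ξ) ^ 2 - ξ ^ 2 + θ ^ 2) + θ * log (h ξ)
    - θ * log (θ + √((h ξ - ξ) ^ 2 - ξ ^ 2 + θ ^ 2)) - θ * thermalEntropy h ξ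

lemma radicand_pos (hh : IsSyngeEOS h) {θ ξ : ℝ} (hξ : 0 < ξ) :
    θ ^ 2 < (h ξ - ξ) ^ 2 - ξ ^ 2 + θ ^ 2 := by
  have := hh.lt_energy hξ
  nlinarith

lemma hasDerivAt_gibbsMin (hh : IsSyngeEOS h) {θ ξ : ℝ} (hθ : 0 < θ) (hξ : 0 < ξ) :
    HasDerivAt (gibbsMin h θ) (((h ξ - ξ) * (deriv h ξ - 1) - ξ) *
      (1 / (θ + √((h ξ - ξ) ^ 2 - ξ ^ 2 + θ ^ 2)) - θ / (ξ * h ξ))) ξ := by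
  have hr := (sq_nonneg θ).trans_lt (hh.radicand_pos (θ := θ) hξ)
  have hB := Real.sqrt_pos.2 hr
  have h1 := (hh.hasDerivAt hξ).fun_sub (hasDerivAt_id' ξ)
  have h2 := (((h1.fun_pow 2).fun_sub ((hasDerivAt_id' ξ).fun_pow 2)).add_const (θ ^ 2)).sqrt hr.ne'
  have hpos : 0 < h ξ := by linarith [hh.pos ξ hξ]
  have h3 := ((h2.fun_add ((hh.hasDerivAt hξ).log hpos.ne' |>.const_mul θ)).fun_sub
    (((h2.const_add θ).log (by positivity)).const_mul θ)).fun_sub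
    ((hh.hasDerivAt_thermalEntropy hξ).const_mul θ)
  refine h3.congr_deriv ?_
  set B := √((h ξ - ξ) ^ 2 - ξ ^ 2 + θ ^ 2) with hBdef
  have hne : θ + B ≠ 0 := by positivity
  have hne2 := hB.ne'
  have hne3 := hpos.ne'
  have hne4 := hξ.ne'
  norm_num
  field_simp
  ring

lemma gibbsMin_self (hh : IsSyngeEOS h) {θ : ℝ} (hθ : 0 < θ) :
    gibbsMin h θ θ = h θ - θ - θ * thermalEntropy h θ := by
  have h1 : √((h θ - θ) ^ 2 - θ ^ 2 + θ ^ 2) = h θ - θ := by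
    rw [sub_add_cancel, Real.sqrt_sq]
    linarith [hh.pos θ hθ]
  rw [gibbsMin, h1]
  ring_nf

lemma gibbs_sign (hh : IsSyngeEOS h) {θ ξ : ℝ} (hθ : 0 < θ) (hξ : 0 < ξ) :
    (θ < ξ → 0 < 1 / (θ + √((h ξ - ξ) ^ 2 - ξ ^ 2 + θ ^ 2)) - θ / (ξ * h ξ)) ∧
    (ξ < θ → 1 / (θ + √((h ξ - ξ) ^ 2 - ξ ^ 2 + θ ^ 2)) - θ / (ξ * h ξ) < 0) := by
  have hr := (sq_nonneg θ).trans_lt (hh.radicand_pos (θ := θ) hξ)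
  have hB := Real.sqrt_pos.2 hr
  have hsq := Real.sq_sqrt hr.le
  set B := √((h ξ - ξ) ^ 2 - ξ ^ 2 + θ ^ 2)
  have hg := hh.lt_energy hξ
  have hpos : 0 < h ξ := by linarith
  have hprod : 0 < ξ * h ξ := by positivity
  -- `ξ² g² - θ² B² = (ξ² - θ²) (g² + θ²)`
  have key : (ξ * (h ξ - ξ)) ^ 2 - (θ * B) ^ 2
      = (ξ ^ 2 - θ ^ 2) * ((h ξ - ξ) ^ 2 + θ ^ 2) := by
    rw [mul_pow θ B, hsq]; ring
  have hfac : 0 < (h ξ - ξ) ^ 2 + θ ^ 2 := by positivity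
  refine ⟨fun hlt => ?_, fun hlt => ?_⟩
  · rw [sub_pos, div_lt_div_iff₀ hprod (by positivity)]
    have h1 : 0 < (ξ ^ 2 - θ ^ 2) * ((h ξ - ξ) ^ 2 + θ ^ 2) := by
      apply mul_pos _ hfac; nlinarith
    have h2 : θ * B < ξ * (h ξ - ξ) :=
      lt_of_pow_lt_pow_left₀ 2 (by nlinarith) (by linarith)
    nlinarith
  · rw [sub_neg, div_lt_div_iff₀ (by positivity) hprod]
    have h1 : (ξ ^ 2 - θ ^ 2) * ((h ξ - ξ) ^ 2 + θ ^ 2) < 0 := by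
      apply mul_neg_of_neg_of_pos _ hfac; nlinarith
    have h2 : ξ * (h ξ - ξ) < θ * B :=
      lt_of_pow_lt_pow_left₀ 2 (by positivity) (by linarith)
    nlinarith

lemma gibbsMin_lt (hh : IsSyngeEOS h) {θ ξ : ℝ} (hθ : 0 < θ) (hξ : 0 < ξ) (hne : ξ ≠ θ) :
    gibbsMin h θ θ < gibbsMin h θ ξ := by
  rcases lt_or_gt_of_ne hne with hlt | hlt
  · refine strictAntiOn_of_deriv_neg (convex_Icc ξ θ) ?_ ?_ (left_mem_Icc.2 hlt.le)
      (right_mem_Icc.2 hlt.le) hlt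
    · exact fun x hx => (hh.hasDerivAt_gibbsMin hθ
        (hξ.trans_le hx.1)).continuousAt.continuousWithinAt
    · intro x hx
      rw [interior_Icc] at hx
      have hx0 := hξ.trans hx.1
      rw [(hh.hasDerivAt_gibbsMin hθ hx0).deriv]
      exact mul_neg_of_pos_of_neg (by linarith [hh.lt_energy_mul_deriv hx0])
        ((hh.gibbs_sign hθ hx0).2 hx.2)
  · refine strictMonoOn_of_deriv_pos (convex_Icc θ ξ) ?_ ?_ (left_mem_Icc.2 hlt.le)
      (right_mem_Icc.2 hlt.le) hlt
    · exact fun x hx => (hh.hasDerivAt_gibbsMin hθ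
        (hθ.trans_le hx.1)).continuousAt.continuousWithinAt
    · intro x hx
      rw [interior_Icc] at hx
      have hx0 := hθ.trans hx.1
      rw [(hh.hasDerivAt_gibbsMin hθ hx0).deriv]
      exact mul_pos (by linarith [hh.lt_energy_mul_deriv hx0]) ((hh.gibbs_sign hθ hx0).1 hx.1)

/-- Minimization over the Lorentz ratio `r`. -/
lemma gibbsMin_le (hh : IsSyngeEOS h) {θ ξ r : ℝ} (hθ : 0 < θ) (hξ : 0 < ξ) (hr : 0 < r) :
    gibbsMin h θ ξ ≤ (h ξ - ξ) * (r + 1 / r) / 2 + ξ * (1 / r - r) / 2 + θ * log r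
      - θ * thermalEntropy h ξ := by
  have hrad := hh.radicand_pos (θ := θ) hξ
  have hr0 := (sq_nonneg θ).trans_lt hrad
  have hB := Real.sqrt_pos.2 hr0
  have hsq := Real.sq_sqrt hr0.le
  have hBθ : θ < √((h ξ - ξ) ^ 2 - ξ ^ 2 + θ ^ 2) :=
    lt_of_pow_lt_pow_left₀ 2 hB.le (by rw [hsq]; exact hrad)
  have hpos : 0 < h ξ := by linarith [hh.pos ξ hξ]
  rw [gibbsMin]
  set B := √((h ξ - ξ) ^ 2 - ξ ^ 2 + θ ^ 2) with hBdef
  -- `r = z h / (θ + B)`, so that the minimum is at `z = 1`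
  obtain ⟨z, hz⟩ : ∃ z, z = r * (θ + B) / h ξ := ⟨_, rfl⟩
  have hz0 : 0 < z := by rw [hz]; positivity
  have hrz : r = z * h ξ / (θ + B) := by rw [hz]; field_simp
  have hlog : log r = log z + log (h ξ) - log (θ + B) := by
    rw [hrz, Real.log_div (by positivity) (by positivity), Real.log_mul hz0.ne' hpos.ne']
  have h1 : (h ξ - 2 * ξ) * r = (B - θ) * z := by
    rw [hrz]
    have : θ + B ≠ 0 := by positivity
    field_simp
    nlinarith
  have h2 : h ξ / r = (B + θ) / z := by
    rw [hrz]
    have : θ + B ≠ 0 := by positivity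
    field_simp
    ring
  have h3 : (h ξ - ξ) * (r + 1 / r) / 2 + ξ * (1 / r - r) / 2
      = ((B - θ) * z + (B + θ) / z) / 2 := by
    rw [← h1, ← h2]; field_simp; ring
  have h4 := Real.log_le_sub_one_of_pos (inv_pos.2 hz0)
  rw [Real.log_inv] at h4
  have h5 : ((B - θ) * z + (B + θ) / z) / 2 - B
      = θ * (z⁻¹ - 1) + (B - θ) * ((z - 1) ^ 2 / (2 * z)) := by field_simp; ring
  have h6 : 0 ≤ (B - θ) * ((z - 1) ^ 2 / (2 * z)) :=
    mul_nonneg (by linarith) (by positivity)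
  rw [h3, hlog]
  nlinarith [mul_le_mul_of_nonneg_left h4 hθ.le]

/-- The thermodynamic inequality behind the concavity of the entropy: `r` plays the role of the
ratio of two Lorentz factors. -/
lemma gibbs_nonneg (hh : IsSyngeEOS h) {θ ξ r : ℝ} (hθ : 0 < θ) (hξ : 0 < ξ) (hr : 0 < r) :
    0 ≤ (h ξ - ξ) * (r + 1 / r) / 2 + ξ * (1 / r - r) / 2 + θ * log r - (h θ - θ)
      - θ * (thermalEntropy h ξ - thermalEntropy h θ) := by
  have h1 := hh.gibbsMin_le hθ hξ hr
  have h2 := hh.gibbsMin_self hθ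
  rcases eq_or_ne ξ θ with rfl | hne
  · linarith
  · linarith [hh.gibbsMin_lt hθ hξ hne]

lemma gibbs_pos (hh : IsSyngeEOS h) {θ ξ r : ℝ} (hθ : 0 < θ) (hξ : 0 < ξ) (hr : 0 < r)
    (hne : ξ ≠ θ) :
    0 < (h ξ - ξ) * (r + 1 / r) / 2 + ξ * (1 / r - r) / 2 + θ * log r - (h θ - θ)
      - θ * (thermalEntropy h ξ - thermalEntropy h θ) := by
  linarith [hh.gibbsMin_le hθ hξ hr, hh.gibbsMin_self hθ, hh.gibbsMin_lt hθ hξ hne]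

end IsSyngeEOS

end

end RelEuler

/-! ### Primitive and conservative variables -/

namespace RelEuler

noncomputable section

/-- The specific entropy as a function of the primitive variables. -/
def primEntropy {d : ℕ} (h : ℝ → ℝ) (V : Prim d) : ℝ :=
  -Real.log V.1 + thermalEntropy h (V.2.2 / V.1)

section Lorentz

variable {d : ℕ} {v : Space d}

lemma one_sub_norm_sq_pos (hv : ‖v‖ < 1) : 0 < 1 - ‖v‖ ^ 2 := by
  nlinarith [norm_nonneg v]

lemma lorentz_pos (hv : ‖v‖ < 1) : 0 < lorentz v :=
  inv_pos.2 (Real.sqrt_pos.2 (one_sub_norm_sq_pos hv))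

lemma lorentz_sq_mul (hv : ‖v‖ < 1) : lorentz v ^ 2 * (1 - ‖v‖ ^ 2) = 1 := by
  rw [lorentz, inv_pow, Real.sq_sqrt (one_sub_norm_sq_pos hv).le]
  exact inv_mul_cancel₀ (one_sub_norm_sq_pos hv).ne'

end Lorentz

variable {d : ℕ} {h : ℝ → ℝ}

/-- The graph of `U ↦ D S(U)` lies strictly below its tangent planes. The difference of the two
sides is `D / θ` times the sum of the thermodynamic expression of `IsSyngeEOS.gibbs_nonneg` with
`r` the ratio of the Lorentz factors, of a multiple of the squared difference of the velocities,
and of `θ (z - 1 - log z)` with `z` the ratio of the densities `D`. -/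
theorem entropy_tangent_lt (hh : IsSyngeEOS h) {V W : Prim d} (hV : V ∈ physPrim d)
    (hW : W ∈ physPrim d) (hne : V ≠ W) :
    (toCons h V).1 * (primEntropy h V - primEntropy h W) <
      (toCons h W).1 - (toCons h V).1 * (h (W.2.2 / W.1) / (W.2.2 / W.1))
        + lorentz W.2.1 / (W.2.2 / W.1)
          * ((toCons h V).2.2 - inner ℝ W.2.1 (toCons h V).2.1) := by
  obtain ⟨ρ, v, p⟩ := V
  obtain ⟨ρ', v', p'⟩ := W
  obtain ⟨hρ, hp, hv⟩ := hV
  obtain ⟨hρ', hp', hv'⟩ := hW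
  dsimp only at hρ hp hv hρ' hp' hv'
  obtain ⟨θ, hθ⟩ : ∃ θ, θ = p / ρ := ⟨_, rfl⟩
  obtain ⟨θ', hθ'⟩ : ∃ θ', θ' = p' / ρ' := ⟨_, rfl⟩
  have hθ0 : 0 < θ := by rw [hθ]; positivity
  have hθ0' : 0 < θ' := by rw [hθ']; positivity
  have hpθ : p = ρ * θ := by rw [hθ]; field_simp
  have hγ := lorentz_pos hv
  have hγ' := lorentz_pos hv'
  have hγ2 := lorentz_sq_mul hv
  have hγ2' := lorentz_sq_mul hv'
  simp only [toCons, primEntropy, ← hθ, ← hθ', inner_smul_right]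
  have hnorm : ‖v - v'‖ ^ 2 = ‖v‖ ^ 2 - 2 * inner ℝ v' v + ‖v'‖ ^ 2 := by
    rw [real_inner_comm]; exact norm_sub_sq_real v v'
  have hr : 0 < lorentz v' / lorentz v := by positivity
  have hK := hh.gibbs_nonneg hθ0' hθ0 hr
  have hK' := hh.gibbs_pos hθ0' hθ0 hr
  rw [Real.log_div hγ'.ne' hγ.ne'] at hK hK'
  have hz : 0 < ρ' * lorentz v' / (ρ * lorentz v) := by positivity
  have hL := Real.log_le_sub_one_of_pos hz
  have hL' := Real.log_lt_sub_one_of_pos hz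
  have hlogz : Real.log (ρ' * lorentz v' / (ρ * lorentz v))
      = Real.log ρ' + Real.log (lorentz v') - Real.log ρ - Real.log (lorentz v) := by
    rw [Real.log_div (by positivity) (by positivity), Real.log_mul hρ'.ne' hγ'.ne',
      Real.log_mul hρ.ne' hγ.ne']
    ring
  rw [hlogz] at hL hL'
  have hpos := hh.pos θ hθ0
  have hh0 : 0 < h θ := by linarith
  set K := (h θ - θ) * (lorentz v' / lorentz v + 1 / (lorentz v' / lorentz v)) / 2
      + θ * (1 / (lorentz v' / lorentz v) - lorentz v' / lorentz v) / 2
      + θ' * (Real.log (lorentz v') - Real.log (lorentz v)) - (h θ' - θ')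
      - θ' * (thermalEntropy h θ - thermalEntropy h θ') with hKdef
  set J := h θ * lorentz v * lorentz v' * ‖v - v'‖ ^ 2 / 2 with hJdef
  set M := θ' * (ρ' * lorentz v' / (ρ * lorentz v) - 1
    - (Real.log ρ' + Real.log (lorentz v') - Real.log ρ - Real.log (lorentz v))) with hMdef
  have hJ : 0 ≤ J := by rw [hJdef]; positivity
  have hM : 0 ≤ M := mul_nonneg hθ0'.le (by linarith)
  -- the difference of the two sides
  have key : ρ' * lorentz v' - ρ * lorentz v * (h θ' / θ') + lorentz v' / θ' *
        (ρ * h θ * lorentz v ^ 2 - p - ρ * h θ * lorentz v ^ 2 * inner ℝ v' v)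
      - ρ * lorentz v * (-Real.log ρ + thermalEntropy h θ
        - (-Real.log ρ' + thermalEntropy h θ'))
      = ρ * lorentz v / θ' * (K + J + M) := by
    have ha : ‖v‖ ^ 2 = 1 - 1 / lorentz v ^ 2 := by field_simp; linarith
    have hb : ‖v'‖ ^ 2 = 1 - 1 / lorentz v' ^ 2 := by field_simp; linarith
    rw [hKdef, hJdef, hMdef, hnorm, ha, hb, hpθ]
    generalize Real.log ρ = l1
    generalize Real.log ρ' = l2
    generalize Real.log (lorentz v) = l3
    generalize Real.log (lorentz v') = l4
    field_simp
    ring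
  suffices hs : 0 < K + J + M by
    have : 0 < ρ * lorentz v / θ' * (K + J + M) := by positivity
    linarith
  by_cases hvv : v = v'
  · subst hvv
    by_cases hθθ : θ = θ'
    · -- the densities differ, as the temperatures agree
      have hρρ : ρ ≠ ρ' := by
        rintro rfl
        apply hne
        have : p = p' := by
          rw [hpθ, hθθ, hθ']; field_simp
        rw [this]
      have hz1 : ρ' * lorentz v / (ρ * lorentz v) ≠ 1 := by
        rw [mul_div_mul_right _ _ hγ.ne']
        intro hc
        exact hρρ ((div_eq_one_iff_eq hρ.ne').1 hc).symm
      have : 0 < M := mul_pos hθ0' (by linarith [hL' hz1])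
      linarith
    · linarith [hK' hθθ]
  · have : 0 < J := by
      have := norm_pos_iff.2 (sub_ne_zero.2 hvv)
      rw [hJdef]; positivity
    linarith

/-- Equality holds at the point of contact of the tangent plane. -/
lemma entropy_tangent_self {W : Prim d} (hW : W ∈ physPrim d) :
    (toCons h W).1 - (toCons h W).1 * (h (W.2.2 / W.1) / (W.2.2 / W.1))
        + lorentz W.2.1 / (W.2.2 / W.1)
          * ((toCons h W).2.2 - inner ℝ W.2.1 (toCons h W).2.1) = 0 := by
  obtain ⟨ρ, v, p⟩ := W
  obtain ⟨hρ, hp, hv⟩ := hW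
  dsimp only at hρ hp hv
  have hγ := lorentz_pos hv
  have hγ2 := lorentz_sq_mul hv
  have ha : ‖v‖ ^ 2 = 1 - 1 / lorentz v ^ 2 := by field_simp; linarith
  simp only [toCons, inner_smul_right, real_inner_self_eq_norm_sq, ha]
  generalize h (p / ρ) = H
  field_simp
  ring

lemma entropy_tangent_le (hh : IsSyngeEOS h) {V W : Prim d} (hV : V ∈ physPrim d)
    (hW : W ∈ physPrim d) :
    (toCons h V).1 * (primEntropy h V - primEntropy h W) ≤
      (toCons h W).1 - (toCons h V).1 * (h (W.2.2 / W.1) / (W.2.2 / W.1))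
        + lorentz W.2.1 / (W.2.2 / W.1)
          * ((toCons h V).2.2 - inner ℝ W.2.1 (toCons h V).2.1) := by
  rcases eq_or_ne V W with rfl | hne
  · rw [entropy_tangent_self hW]; simp
  · exact (entropy_tangent_lt hh hV hW hne).le

lemma toCons_fst_pos {V : Prim d} (hV : V ∈ physPrim d) : 0 < (toCons h V).1 :=
  mul_pos hV.1 (lorentz_pos hV.2.2)

/-- Two states with the same conservative variables would each have less entropy than the
other. -/
theorem injOn_toCons (hh : IsSyngeEOS h) : InjOn (toCons h) (physPrim d) := by
  intro V hV W hW heq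
  by_contra hne
  have h1 := entropy_tangent_lt hh hV hW hne
  have h2 := entropy_tangent_lt hh hW hV (Ne.symm hne)
  rw [heq, entropy_tangent_self hW] at h1
  rw [← heq, entropy_tangent_self hV] at h2
  have hD := toCons_fst_pos (h := h) hV
  rw [← heq] at h1
  nlinarith

lemma toPrim_mem {u : State d} (hu : u ∈ admissible d h) : toPrim h u ∈ physPrim d :=
  Function.invFunOn_mem hu

lemma toCons_toPrim {u : State d} (hu : u ∈ admissible d h) : toCons h (toPrim h u) = u :=
  Function.invFunOn_eq hu

lemma toPrim_toCons (hh : IsSyngeEOS h) {V : Prim d} (hV : V ∈ physPrim d) :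
    toPrim h (toCons h V) = V :=
  injOn_toCons hh (toPrim_mem ⟨V, hV, rfl⟩) hV (toCons_toPrim ⟨V, hV, rfl⟩)

lemma isOpen_physPrim : IsOpen (physPrim d) :=
  (isOpen_lt continuous_const continuous_fst).inter
    ((isOpen_lt continuous_const (continuous_snd.comp continuous_snd)).inter
      (isOpen_lt (continuous_norm.comp (continuous_fst.comp continuous_snd)) continuous_const))

lemma contDiffAt_lorentz {v : Space d} (hv : ‖v‖ < 1) : ContDiffAt ℝ 1 (lorentz (d := d)) v := by
  have h1 := one_sub_norm_sq_pos hv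
  exact ((contDiff_const.sub (contDiff_norm_sq ℝ)).contDiffAt.sqrt h1.ne').inv
    (Real.sqrt_pos.2 h1).ne'

lemma contDiffAt_theta {V : Prim d} (hV : V ∈ physPrim d) :
    ContDiffAt ℝ 1 (fun V : Prim d => V.2.2 / V.1) V :=
  (contDiff_snd.comp contDiff_snd).contDiffAt.div contDiff_fst.contDiffAt hV.1.ne'

lemma contDiffAt_toCons (hh : IsSyngeEOS h) {V : Prim d} (hV : V ∈ physPrim d) :
    ContDiffAt ℝ 1 (toCons h) V := by
  have h1 : ContDiffAt ℝ 1 (fun V : Prim d => V.1) V := contDiff_fst.contDiffAt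
  have h2 : ContDiffAt ℝ 1 (fun V : Prim d => V.2.1) V :=
    (contDiff_fst.comp contDiff_snd).contDiffAt
  have h3 : ContDiffAt ℝ 1 (fun V : Prim d => V.2.2) V :=
    (contDiff_snd.comp contDiff_snd).contDiffAt
  have h4 : ContDiffAt ℝ 1 (fun V : Prim d => lorentz V.2.1) V :=
    ContDiffAt.comp (f := fun V : Prim d => V.2.1) (g := lorentz) V (contDiffAt_lorentz hV.2.2) h2
  have h5 : ContDiffAt ℝ 1 (fun V : Prim d => h (V.2.2 / V.1)) V :=
    ContDiffAt.comp (f := fun V : Prim d => V.2.2 / V.1) (g := h) V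
      (hh.contDiffOn.contDiffAt (Ioi_mem_nhds (div_pos hV.2.1 hV.1))) (contDiffAt_theta hV)
  exact (h1.mul h4).prodMk ((((h1.mul h5).mul (h4.pow 2)).smul h2).prodMk
    (((h1.mul h5).mul (h4.pow 2)).sub h3))

lemma contDiffAt_primEntropy (hh : IsSyngeEOS h) {V : Prim d} (hV : V ∈ physPrim d) :
    ContDiffAt ℝ 1 (primEntropy h) V :=
  (contDiff_fst.contDiffAt.log hV.1.ne').neg.add
    (ContDiffAt.comp (f := fun V : Prim d => V.2.2 / V.1) (g := thermalEntropy h) V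
      (hh.contDiffOn_thermalEntropy.contDiffAt (Ioi_mem_nhds (div_pos hV.2.1 hV.1)))
      (contDiffAt_theta hV))

/-- The algebraic relations between conservative and primitive variables. -/
lemma toCons_relations {V : Prim d} (hV : V ∈ physPrim d) :
    (toCons h V).1 ^ 2 * (1 - ‖V.2.1‖ ^ 2) = V.1 ^ 2 ∧
    (toCons h V).2.1 = ((toCons h V).2.2 + V.2.2) • V.2.1 ∧
    (toCons h V).2.2 - inner ℝ (toCons h V).2.1 V.2.1
      = V.1 * (h (V.2.2 / V.1) - V.2.2 / V.1) := by
  obtain ⟨ρ, v, p⟩ := V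
  obtain ⟨hρ, hp, hv⟩ := hV
  dsimp only at hρ hp hv
  have hγ2 := lorentz_sq_mul hv
  refine ⟨?_, ?_, ?_⟩
  · simp only [toCons, mul_pow]
    rw [mul_assoc, hγ2, mul_one]
  · simp only [toCons, sub_add_cancel]
  · simp only [toCons, inner_smul_left, real_inner_self_eq_norm_sq]
    have : ρ * (h (p / ρ) - p / ρ) = ρ * h (p / ρ) - p := by field_simp
    rw [this]
    simp only [conj_trivial]
    linear_combination (ρ * h (p / ρ)) * hγ2

lemma hasDerivAt_fst_comp {E F : Type*} [NormedAddCommGroup E] [NormedSpace ℝ E]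
    [NormedAddCommGroup F] [NormedSpace ℝ F] {f : ℝ → E × F} {f' : E × F} {s : ℝ}
    (hf : HasDerivAt f f' s) : HasDerivAt (fun s => (f s).1) f'.1 s := by
  simpa using hf.hasFDerivAt.fst.hasDerivAt

lemma hasDerivAt_snd_comp {E F : Type*} [NormedAddCommGroup E] [NormedSpace ℝ E]
    [NormedAddCommGroup F] [NormedSpace ℝ F] {f : ℝ → E × F} {f' : E × F} {s : ℝ}
    (hf : HasDerivAt f f' s) : HasDerivAt (fun s => (f s).2) f'.2 s := by
  simpa using hf.hasFDerivAt.snd.hasDerivAt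

/-- The linearized relations between conservative and primitive variables. -/
lemma fderiv_toCons_relations (hh : IsSyngeEOS h) {V : Prim d} (hV : V ∈ physPrim d)
    (ζ : Prim d) :
    (toCons h V).1 * (fderiv ℝ (toCons h) V ζ).1 * (1 - ‖V.2.1‖ ^ 2)
      - (toCons h V).1 ^ 2 * inner ℝ V.2.1 ζ.2.1 = V.1 * ζ.1 ∧
    (fderiv ℝ (toCons h) V ζ).2.1 = ((fderiv ℝ (toCons h) V ζ).2.2 + ζ.2.2) • V.2.1
      + ((toCons h V).2.2 + V.2.2) • ζ.2.1 ∧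
    (fderiv ℝ (toCons h) V ζ).2.2 - inner ℝ (fderiv ℝ (toCons h) V ζ).2.1 V.2.1
      - inner ℝ (toCons h V).2.1 ζ.2.1
      = (h (V.2.2 / V.1) - V.2.2 / V.1) * ζ.1
        + (deriv h (V.2.2 / V.1) - 1) * (ζ.2.2 - V.2.2 / V.1 * ζ.1) := by
  have hd := ((contDiffAt_toCons hh hV).differentiableAt one_ne_zero).hasFDerivAt
  set w := fderiv ℝ (toCons h) V ζ with hw
  have hc0 : HasDerivAt (fun s : ℝ => V + s • ζ) ζ 0 := by
    simpa using ((hasDerivAt_id (0 : ℝ)).smul_const ζ).const_add V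
  have hev : ∀ᶠ s : ℝ in 𝓝 0, V + s • ζ ∈ physPrim d := by
    have := hc0.continuousAt
    apply this.eventually_mem
    simpa using isOpen_physPrim.mem_nhds hV
  have hu : HasDerivAt (fun s : ℝ => toCons h (V + s • ζ)) w 0 := by
    have hd' : HasFDerivAt (toCons h) (fderiv ℝ (toCons h) V) (V + (0 : ℝ) • ζ) := by simpa using hd
    exact hd'.comp_hasDerivAt 0 hc0
  have hu1 : HasDerivAt (fun s : ℝ => (toCons h (V + s • ζ)).1) w.1 0 :=
    hasDerivAt_fst_comp hu
  have hu23 : HasDerivAt (fun s : ℝ => (toCons h (V + s • ζ)).2) w.2 0 :=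
    hasDerivAt_snd_comp hu
  have hu2 : HasDerivAt (fun s : ℝ => (toCons h (V + s • ζ)).2.1) w.2.1 0 :=
    hasDerivAt_fst_comp hu23
  have hu3 : HasDerivAt (fun s : ℝ => (toCons h (V + s • ζ)).2.2) w.2.2 0 :=
    hasDerivAt_snd_comp hu23
  have hc1 : HasDerivAt (fun s : ℝ => (V + s • ζ).1) ζ.1 0 :=
    hasDerivAt_fst_comp hc0
  have hc23 : HasDerivAt (fun s : ℝ => (V + s • ζ).2) ζ.2 0 :=
    hasDerivAt_snd_comp hc0
  have hc2 : HasDerivAt (fun s : ℝ => (V + s • ζ).2.1) ζ.2.1 0 :=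
    hasDerivAt_fst_comp hc23
  have hc3 : HasDerivAt (fun s : ℝ => (V + s • ζ).2.2) ζ.2.2 0 :=
    hasDerivAt_snd_comp hc23
  have e0 : V + (0 : ℝ) • ζ = V := by simp
  have hρ := hV.1
  have hθ0 : 0 < V.2.2 / V.1 := div_pos hV.2.1 hV.1
  refine ⟨?_, ?_, ?_⟩
  · have hl := (hu1.fun_pow 2).fun_mul (hc2.norm_sq.const_sub 1)
    have hr := (hc1.fun_pow 2).congr_of_eventuallyEq
      (hev.mono fun s hs => (toCons_relations (h := h) hs).1)
    have := hl.unique hr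
    simp only [e0] at this
    norm_num at this
    linarith
  · have hr := ((hu3.fun_add hc3).fun_smul hc2).congr_of_eventuallyEq
      (hev.mono fun s hs => (toCons_relations (h := h) hs).2.1)
    have := hu2.unique hr
    simp only [e0] at this
    rw [this, add_comm]
  · have hq := hc3.fun_div hc1 (by rw [e0]; exact hρ.ne')
    have hh' : HasDerivAt h (deriv h (V.2.2 / V.1)) ((V + (0 : ℝ) • ζ).2.2 / (V + (0 : ℝ) • ζ).1) := by
      rw [e0]; exact hh.hasDerivAt hθ0
    have hr := (hc1.fun_mul ((hh'.comp 0 hq).fun_sub hq)).congr_of_eventuallyEq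
      (hev.mono fun s hs => (toCons_relations (h := h) hs).2.2)
    have hl := hu3.fun_sub (hu2.inner ℝ hc2)
    have := hl.unique hr
    simp only [e0, Function.comp_apply] at this
    rw [← sub_sub, sub_right_comm] at this
    rw [this]
    field_simp

/-- Causality makes the Jacobian of the map from primitive to conservative variables
nonsingular. -/
lemma fderiv_toCons_injective (hh : IsSyngeEOS h) {V : Prim d} (hV : V ∈ physPrim d) :
    Function.Injective (fderiv ℝ (toCons h) V) := by
  rw [injective_iff_map_eq_zero]
  intro ζ hζ
  obtain ⟨r1, r2, r3⟩ := fderiv_toCons_relations hh hV ζ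
  rw [hζ] at r1 r2 r3
  obtain ⟨ρ, v, p⟩ := V
  obtain ⟨ρ', v', p'⟩ := ζ
  obtain ⟨hρ, hp, hv⟩ := hV
  dsimp only at hρ hp hv
  have hγ := lorentz_pos hv
  have hθ : 0 < p / ρ := div_pos hp hρ
  have hg := hh.pos _ hθ
  have hcaus := hh.lt_energy_mul_deriv hθ
  simp only [toCons, Prod.fst_zero, Prod.snd_zero, zero_add, mul_zero, zero_mul, zero_sub,
    inner_zero_left, sub_zero, inner_smul_left, conj_trivial, sub_add_cancel] at r1 r2 r3
  set θ := p / ρ with hθdef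
  set γ := lorentz v
  set H := h θ
  have hH : 0 < H := by linarith
  have hA : 0 < ρ * H * γ ^ 2 := by positivity
  have hv' : v' = (-(p' / (ρ * H * γ ^ 2))) • v := by
    have h0 : (ρ * H * γ ^ 2) • v' = (-p') • v := by
      rw [neg_smul]; exact (eq_neg_of_add_eq_zero_right r2.symm)
    rw [← inv_smul_smul₀ hA.ne' v', h0, smul_smul]
    congr 1; field_simp
  have hin : inner ℝ v v' = -(p' / (ρ * H * γ ^ 2)) * ‖v‖ ^ 2 := by
    rw [hv', inner_smul_right, real_inner_self_eq_norm_sq]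
  rw [hin] at r1 r3
  have hρ' : ρ' = p' * ‖v‖ ^ 2 / H := by
    field_simp at r1 ⊢
    linarith
  have h3 : p' * ((H - θ) * (‖v‖ ^ 2) + (deriv h θ - 1) * (H - θ * ‖v‖ ^ 2) - ‖v‖ ^ 2 * H) = 0 := by
    rw [hρ'] at r3
    field_simp at r3
    linarith
  have hn1 : 0 < 1 - ‖v‖ ^ 2 := one_sub_norm_sq_pos hv
  have hpos : 0 < (H - θ) * (‖v‖ ^ 2) + (deriv h θ - 1) * (H - θ * ‖v‖ ^ 2) - ‖v‖ ^ 2 * H := by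
    have h5 : 0 < H - θ * ‖v‖ ^ 2 := by nlinarith
    have h6 : 0 < H - θ := by linarith
    have h7 : θ * (H - θ * ‖v‖ ^ 2) < ((H - θ) * (deriv h θ - 1)) * (H - θ * ‖v‖ ^ 2) :=
      mul_lt_mul_of_pos_right hcaus h5
    have h8 : 0 < (H - θ) * ((H - θ) * (‖v‖ ^ 2) + (deriv h θ - 1) * (H - θ * ‖v‖ ^ 2)
        - ‖v‖ ^ 2 * H) := by
      nlinarith [mul_pos (mul_pos hθ hH) hn1]
    exact pos_of_mul_pos_right h8 h6.le
  have hp0 : p' = 0 := by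
    rcases mul_eq_zero.1 h3 with h9 | h9
    · exact h9
    · exact absurd h9 hpos.ne'
  rw [hp0] at hv' hρ'
  simp only [zero_div, neg_zero, zero_smul, zero_mul] at hv' hρ'
  rw [hv', hρ', hp0]
  rfl

/-- The inverse function theorem for `toCons`. -/
lemma toCons_local_inverse (hh : IsSyngeEOS h) {V : Prim d} (hV : V ∈ physPrim d) :
    admissible d h ∈ 𝓝 (toCons h V) ∧ ContDiffAt ℝ 1 (toPrim h) (toCons h V) := by
  have hc := contDiffAt_toCons hh hV
  let L : Prim d ≃L[ℝ] State d := (LinearEquiv.ofInjectiveEndo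
    ((fderiv ℝ (toCons h) V : Prim d →L[ℝ] State d) : Prim d →ₗ[ℝ] State d)
    (fderiv_toCons_injective hh hV)).toContinuousLinearEquiv
  have hL : (L : Prim d →L[ℝ] State d) = fderiv ℝ (toCons h) V := by
    exact ContinuousLinearMap.ext fun x => rfl
  have hd : HasFDerivAt (toCons h) (L : Prim d →L[ℝ] State d) V := by
    rw [hL]; exact (hc.differentiableAt one_ne_zero).hasFDerivAt
  have hinv := hc.to_localInverse hd one_ne_zero
  have hval : hc.localInverse hd one_ne_zero (toCons h V) = V := by
    exact hc.localInverse_apply_image hd one_ne_zero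
  have hst := hc.hasStrictFDerivAt' hd one_ne_zero
  have hright : ∀ᶠ y in 𝓝 (toCons h V), toCons h (hc.localInverse hd one_ne_zero y) = y :=
    hst.eventually_right_inverse
  have hmem : ∀ᶠ y in 𝓝 (toCons h V), hc.localInverse hd one_ne_zero y ∈ physPrim d := by
    apply hinv.continuousAt.eventually_mem
    rw [hval]
    exact isOpen_physPrim.mem_nhds hV
  refine ⟨?_, ?_⟩
  · filter_upwards [hright, hmem] with y h1 h2 using ⟨_, h2, h1⟩
  · refine hinv.congr_of_eventuallyEq ?_
    filter_upwards [hright, hmem] with y h1 h2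
    conv_lhs => rw [← h1]
    exact toPrim_toCons hh h2

lemma isOpen_admissible (hh : IsSyngeEOS h) : IsOpen (admissible d h) := by
  rw [isOpen_iff_mem_nhds]
  rintro _ ⟨V, hV, rfl⟩
  exact (toCons_local_inverse hh hV).1

lemma contDiffAt_toPrim (hh : IsSyngeEOS h) {u : State d} (hu : u ∈ admissible d h) :
    ContDiffAt ℝ 1 (toPrim h) u := by
  have := (toCons_local_inverse hh (toPrim_mem hu)).2
  rwa [toCons_toPrim hu] at this

/-- The derivatives of `toCons` and `toPrim` are inverse to each other. -/
lemma fderiv_toCons_fderiv_toPrim (hh : IsSyngeEOS h) {u : State d} (hu : u ∈ admissible d h)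
    (w : State d) : fderiv ℝ (toCons h) (toPrim h u) (fderiv ℝ (toPrim h) u w) = w := by
  have h1 := ((contDiffAt_toPrim hh hu).differentiableAt one_ne_zero).hasFDerivAt
  have h2 := ((contDiffAt_toCons hh (toPrim_mem hu)).differentiableAt one_ne_zero).hasFDerivAt
  have h3 := (h2.comp u h1).congr_of_eventuallyEq
    (f₁ := id) (Filter.Eventually.mono ((isOpen_admissible hh).mem_nhds hu)
      fun y hy => (toCons_toPrim hy).symm)
  have := h3.unique (hasFDerivAt_id u)
  exact DFunLike.congr_fun this w

lemma fderiv_toPrim_fderiv_toCons (hh : IsSyngeEOS h) {u : State d} (hu : u ∈ admissible d h)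
    (ζ : Prim d) : fderiv ℝ (toPrim h) u (fderiv ℝ (toCons h) (toPrim h u) ζ) = ζ :=
  fderiv_toCons_injective hh (toPrim_mem hu) (fderiv_toCons_fderiv_toPrim hh hu _)

/-- The set of admissible states in terms of the conservative variables. -/
lemma mem_admissible_iff (hh : IsSyngeEOS h) {u : State d} :
    u ∈ admissible d h ↔
      0 < u.1 ∧ 0 < u.2.2 ∧ (restEnergy h * u.1) ^ 2 + ‖u.2.1‖ ^ 2 < u.2.2 ^ 2 := by
  constructor
  · rintro ⟨⟨ρ, v, p⟩, ⟨hρ, hp, hv⟩, rfl⟩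
    dsimp only at hρ hp hv
    have hγ := lorentz_pos hv
    have hγ2 := lorentz_sq_mul hv
    have hθ : 0 < p / ρ := div_pos hp hρ
    have hpθ : p = ρ * (p / ρ) := by field_simp
    have hg := hh.pos _ hθ
    have hg2 := hh.restEnergy_sq_le hθ
    simp only [toCons, norm_smul, mul_pow, norm_pow, norm_mul, Real.norm_eq_abs, sq_abs]
    set θ := p / ρ
    set γ := lorentz v
    have hγ1 : 1 ≤ γ ^ 2 := by nlinarith [mul_nonneg (sq_nonneg γ) (sq_nonneg ‖v‖)]
    refine ⟨by positivity, ?_, ?_⟩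
    · have : 0 < ρ * (h θ * γ ^ 2 - θ) := mul_pos hρ (by nlinarith)
      rw [hpθ]; linarith
    · have e2 : (γ ^ 2) ^ 2 = γ ^ 4 := by ring
      have e1 : γ ^ 4 * ‖v‖ ^ 2 = γ ^ 4 - γ ^ 2 := by linear_combination (-γ ^ 2) * hγ2
      have e3 : (ρ * h θ * γ ^ 2 - p) ^ 2 - ρ ^ 2 * h θ ^ 2 * (γ ^ 4 * ‖v‖ ^ 2)
          = ρ ^ 2 * γ ^ 2 * ((h θ - θ) ^ 2 - θ ^ 2) + p ^ 2 := by
        rw [e1, hpθ]; ring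
      have e4 : restEnergy h ^ 2 * (ρ ^ 2 * γ ^ 2)
          ≤ ((h θ - θ) ^ 2 - θ ^ 2) * (ρ ^ 2 * γ ^ 2) :=
        mul_le_mul_of_nonneg_right hg2 (by positivity)
      rw [e2]
      nlinarith [pow_pos hp 2]
  · rintro ⟨hD, hE, hlt⟩
    obtain ⟨D, m, E⟩ := u
    dsimp only at hD hE hlt
    set a := restEnergy h with ha
    have hM : ‖m‖ ^ 2 < E ^ 2 := by nlinarith [sq_nonneg (a * D)]
    -- the squared inverse Lorentz factor, the density and the defect in the energy equation,
    -- as functions of the unknown pressure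
    let k : ℝ → ℝ := fun p => 1 - ‖m‖ ^ 2 / (E + p) ^ 2
    let ϱ : ℝ → ℝ := fun p => D * √(k p)
    let Φ : ℝ → ℝ := fun p => E - ‖m‖ ^ 2 / (E + p) - ϱ p * (h (p / ϱ p) - p / ϱ p)
    have hk : ∀ p, 0 ≤ p → 0 < k p := by
      intro p hp
      have : ‖m‖ ^ 2 / (E + p) ^ 2 < 1 := by
        rw [div_lt_one (by positivity)]; nlinarith
      simp only [k]; linarith
    have hϱ : ∀ p, 0 ≤ p → 0 < ϱ p := fun p hp => mul_pos hD (Real.sqrt_pos.2 (hk p hp))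
    have hkc : ∀ p, 0 ≤ p → ContinuousAt k p := fun p hp =>
      continuousAt_const.sub (continuousAt_const.div ((continuousAt_const.add continuousAt_id).pow 2)
        (by have : 0 < E + p := by linarith
            exact pow_ne_zero 2 this.ne'))
    have hϱc : ∀ p, 0 ≤ p → ContinuousAt ϱ p := fun p hp =>
      continuousAt_const.mul (hkc p hp).sqrt
    have hΦc : ContinuousOn Φ (Ioi 0) := by
      intro p hp
      have hp' : 0 < p := hp
      have h1 : ContinuousAt (fun p => p / ϱ p) p :=
        continuousAt_id.div (hϱc p hp'.le) (hϱ p hp'.le).ne'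
      have h2 : ContinuousAt (fun p => h (p / ϱ p)) p :=
        ContinuousAt.comp (f := fun p => p / ϱ p) (g := h)
          (hh.hasDerivAt (div_pos hp' (hϱ p hp'.le))).continuousAt h1
      have h3 : ContinuousAt (fun p => ‖m‖ ^ 2 / (E + p)) p :=
        continuousAt_const.div (continuousAt_const.add continuousAt_id) (by
          have : 0 < E + p := by linarith
          exact this.ne')
      exact ((continuousAt_const.sub h3).sub
        ((hϱc p hp'.le).mul (h2.sub h1))).continuousWithinAt
    have hlim : Tendsto Φ (𝓝[>] 0) (𝓝 (E - ‖m‖ ^ 2 / (E + 0) - ϱ 0 * a)) := by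
      have h1 : Tendsto (fun p => p / ϱ p) (𝓝[>] 0) (𝓝[>] 0) := by
        refine tendsto_nhdsWithin_iff.2 ⟨?_, ?_⟩
        · have : ContinuousAt (fun p => p / ϱ p) 0 :=
            continuousAt_id.div (hϱc 0 le_rfl) (hϱ 0 le_rfl).ne'
          simpa using this.tendsto.mono_left nhdsWithin_le_nhds
        · filter_upwards [self_mem_nhdsWithin] with p hp
          exact div_pos hp (hϱ p (le_of_lt hp))
      have h2 := hh.tendsto_energy.comp h1
      have h3 : ContinuousAt (fun p => ‖m‖ ^ 2 / (E + p)) 0 :=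
        continuousAt_const.div (continuousAt_const.add continuousAt_id) (by simpa using hE.ne')
      exact ((tendsto_const_nhds.sub (h3.tendsto.mono_left nhdsWithin_le_nhds))).sub
        (((hϱc 0 le_rfl).tendsto.mono_left nhdsWithin_le_nhds).mul h2)
    have hlimpos : 0 < E - ‖m‖ ^ 2 / (E + 0) - ϱ 0 * a := by
      have hs := Real.sqrt_pos.2 (hk 0 le_rfl)
      have hss := Real.sq_sqrt (hk 0 le_rfl).le
      have h1 : E - ‖m‖ ^ 2 / (E + 0) = E * √(k 0) ^ 2 := by
        rw [hss]; simp only [k, add_zero]; field_simp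
      have h3 : (E * √(k 0)) ^ 2 = E ^ 2 - ‖m‖ ^ 2 := by
        rw [mul_pow, hss]; simp only [k, add_zero]; field_simp
      have h2 : a * D < E * √(k 0) :=
        lt_of_pow_lt_pow_left₀ 2 (by positivity) (by rw [h3]; linarith)
      rw [h1]
      simp only [ϱ]
      nlinarith
    obtain ⟨p₀, hp₀, hp₀E, hΦ₀⟩ : ∃ p, 0 < p ∧ p < E ∧ 0 < Φ p := by
      have h1 := hlim.eventually_const_lt hlimpos
      obtain ⟨p, h2, h3⟩ := (h1.and (Ioo_mem_nhdsGT hE)).exists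
      exact ⟨p, h3.1, h3.2, h2⟩
    have hΦE : Φ E < 0 := by
      have h1 := hϱ E hE.le
      have h2 := hh.lt_energy (div_pos hE h1)
      have h3 : ϱ E * (E / ϱ E) < ϱ E * (h (E / ϱ E) - E / ϱ E) := mul_lt_mul_of_pos_left h2 h1
      rw [mul_div_cancel₀ _ h1.ne'] at h3
      have h4 : 0 ≤ ‖m‖ ^ 2 / (E + E) := by positivity
      simp only [Φ]; linarith
    obtain ⟨p, ⟨hp1, hp2⟩, hp⟩ : ∃ p ∈ Icc p₀ E, Φ p = 0 :=
      intermediate_value_Icc' hp₀E.le (hΦc.mono fun x hx => hp₀.trans_le hx.1) ⟨hΦE.le, hΦ₀.le⟩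
    have hp0 : 0 < p := hp₀.trans_le hp1
    have hEp : 0 < E + p := by linarith
    have hρp := hϱ p hp0.le
    have hkp := hk p hp0.le
    have hvn : ‖(E + p)⁻¹ • m‖ ^ 2 = ‖m‖ ^ 2 / (E + p) ^ 2 := by
      rw [norm_smul, mul_pow, norm_inv, Real.norm_eq_abs, abs_of_pos hEp]; field_simp
    have hlor : lorentz ((E + p)⁻¹ • m) = (√(k p))⁻¹ := by rw [lorentz, hvn]
    have hv1 : ‖(E + p)⁻¹ • m‖ < 1 := by
      have : ‖(E + p)⁻¹ • m‖ ^ 2 < 1 ^ 2 := by rw [hvn]; simp only [k] at hkp; linarith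
      exact lt_of_pow_lt_pow_left₀ 2 zero_le_one this
    have hs := Real.sqrt_pos.2 hkp
    have hss := Real.sq_sqrt hkp.le
    have hmain : ϱ p * h (p / ϱ p) * (√(k p))⁻¹ ^ 2 = E + p := by
      have h1 : ϱ p * h (p / ϱ p) = E - ‖m‖ ^ 2 / (E + p) + p := by
        have h2 : ϱ p * (h (p / ϱ p) - p / ϱ p) = ϱ p * h (p / ϱ p) - p := by
          rw [mul_sub, mul_div_cancel₀ _ hρp.ne']
        simp only [Φ] at hp
        linarith
      rw [h1, inv_pow, hss, mul_inv_eq_iff_eq_mul₀ hkp.ne']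
      simp only [k]
      field_simp
      ring
    refine ⟨(ϱ p, (E + p)⁻¹ • m, p), ⟨hρp, hp0, hv1⟩, ?_⟩
    simp only [toCons, hlor]
    rw [hmain]
    refine Prod.ext ?_ (Prod.ext ?_ ?_)
    · simp only [ϱ]; field_simp
    · simp only; rw [smul_smul, mul_inv_cancel₀ hEp.ne', one_smul]
    · simp

lemma convex_admissible (hh : IsSyngeEOS h) : Convex ℝ (admissible d h) := by
  intro u hu w hw α β hα hβ hαβ
  rw [mem_admissible_iff hh] at hu hw ⊢
  obtain ⟨D, m, E⟩ := u
  obtain ⟨D', m', E'⟩ := w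
  obtain ⟨hD, hE, hlt⟩ := hu
  obtain ⟨hD', hE', hlt'⟩ := hw
  dsimp only at hD hE hlt hD' hE' hlt'
  simp only [Prod.smul_mk, Prod.mk_add_mk, smul_eq_mul]
  have hpos : ∀ x y : ℝ, 0 < x → 0 < y → 0 < α * x + β * y := by
    intro x y hx hy
    rcases hα.eq_or_lt with rfl | h1
    · have : β = 1 := by linarith
      rw [this]; linarith
    · have : 0 ≤ β * y := by positivity
      have : 0 < α * x := by positivity
      linarith
  refine ⟨hpos _ _ hD hD', hpos _ _ hE hE', ?_⟩
  set a := restEnergy h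
  have hcs : (a * D) * (a * D') + ‖m‖ * ‖m'‖ ≤ E * E' := by
    refine le_of_lt (lt_of_pow_lt_pow_left₀ 2 (by positivity) ?_)
    have h1 : ((a * D) ^ 2 + ‖m‖ ^ 2) * ((a * D') ^ 2 + ‖m'‖ ^ 2) < E ^ 2 * E' ^ 2 :=
      mul_lt_mul'' hlt hlt' (by positivity) (by positivity)
    nlinarith [sq_nonneg ((a * D) * ‖m'‖ - (a * D') * ‖m‖)]
  have hn : ‖α • m + β • m'‖ ≤ α * ‖m‖ + β * ‖m'‖ := by
    refine (norm_add_le _ _).trans (le_of_eq ?_)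
    rw [norm_smul, norm_smul, Real.norm_of_nonneg hα, Real.norm_of_nonneg hβ]
  have hn2 : ‖α • m + β • m'‖ ^ 2 ≤ (α * ‖m‖ + β * ‖m'‖) ^ 2 := pow_le_pow_left₀ (norm_nonneg _) hn 2
  have hx : 0 < α ^ 2 * (E ^ 2 - ((a * D) ^ 2 + ‖m‖ ^ 2))
      + β ^ 2 * (E' ^ 2 - ((a * D') ^ 2 + ‖m'‖ ^ 2)) := by
    rcases hα.eq_or_lt with h0 | h0
    · have : β = 1 := by linarith
      rw [this, ← h0]; nlinarith
    · have h1 : 0 < α ^ 2 * (E ^ 2 - ((a * D) ^ 2 + ‖m‖ ^ 2)) :=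
        mul_pos (by positivity) (by linarith)
      have h2 : 0 ≤ β ^ 2 * (E' ^ 2 - ((a * D') ^ 2 + ‖m'‖ ^ 2)) :=
        mul_nonneg (by positivity) (by linarith)
      linarith
  nlinarith [mul_le_mul_of_nonneg_left hcs (mul_nonneg hα hβ)]

end

end RelEuler

/-! ### Convex entropies and characteristic speeds -/

namespace RelEuler

noncomputable section

variable {d : ℕ} {h : ℝ → ℝ}

/-- The covector `-(h/θ) dD - (γ/θ) v · dm + (γ/θ) dE`, which is `D dS` by Gibbs' relation
`fst_mul_fderiv_specificEntropy`. -/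
def entropyGradient (h : ℝ → ℝ) (u : State d) : State d →L[ℝ] ℝ :=
  (-(h (theta h u) / theta h u)) • ContinuousLinearMap.fst ℝ ℝ (Space d × ℝ)
    + (lorentz (velocity h u) / theta h u) •
      ((ContinuousLinearMap.snd ℝ (Space d) ℝ).comp (ContinuousLinearMap.snd ℝ ℝ (Space d × ℝ))
        - (innerSL ℝ (velocity h u)).comp
          ((ContinuousLinearMap.fst ℝ (Space d) ℝ).comp
            (ContinuousLinearMap.snd ℝ ℝ (Space d × ℝ))))

lemma entropyGradient_apply (h : ℝ → ℝ) (u w : State d) :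
    entropyGradient h u w = -(h (theta h u) / theta h u) * w.1
      + lorentz (velocity h u) / theta h u * (w.2.2 - inner ℝ (velocity h u) w.2.1) := rfl

lemma specificEntropy_tangent (hh : IsSyngeEOS h) {u w : State d} (hu : u ∈ admissible d h)
    (hw : w ∈ admissible d h) :
    u.1 * (specificEntropy h u - specificEntropy h w) ≤ w.1 + entropyGradient h w u := by
  have := entropy_tangent_le hh (toPrim_mem hu) (toPrim_mem hw)
  rw [toCons_toPrim hu, toCons_toPrim hw] at this
  rw [entropyGradient_apply]
  refine this.trans (le_of_eq ?_)
  simp only [theta, density, pressure, velocity]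
  ring

lemma specificEntropy_tangent_self {w : State d} (hw : w ∈ admissible d h) :
    w.1 + entropyGradient h w w = 0 := by
  have := entropy_tangent_self (h := h) (toPrim_mem hw)
  rw [toCons_toPrim hw] at this
  rw [entropyGradient_apply, ← this]
  simp only [theta, density, pressure, velocity]
  ring

lemma fst_pos_of_mem {u : State d} (hu : u ∈ admissible d h) : 0 < u.1 := by
  have := toCons_fst_pos (h := h) (toPrim_mem hu)
  rwa [toCons_toPrim hu] at this

/-- Concavity of `D S`. -/
lemma specificEntropy_concave (hh : IsSyngeEOS h) {u w : State d} (hu : u ∈ admissible d h)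
    (hw : w ∈ admissible d h) {α β : ℝ} (hα : 0 ≤ α) (hβ : 0 ≤ β) (hαβ : α + β = 1) :
    α * (u.1 * specificEntropy h u) + β * (w.1 * specificEntropy h w)
      ≤ (α • u + β • w).1 * specificEntropy h (α • u + β • w) := by
  have hx := convex_admissible hh hu hw hα hβ hαβ
  have h1 := mul_le_mul_of_nonneg_left (specificEntropy_tangent hh hu hx) hα
  have h2 := mul_le_mul_of_nonneg_left (specificEntropy_tangent hh hw hx) hβ
  have h3 := specificEntropy_tangent_self hx
  have h4 : entropyGradient h (α • u + β • w) (α • u + β • w)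
      = α * entropyGradient h (α • u + β • w) u + β * entropyGradient h (α • u + β • w) w := by
    conv_lhs => rw [map_add, map_smul, map_smul, smul_eq_mul, smul_eq_mul]
  rw [h4] at h3
  have h5 : (α • u + β • w).1 = α * u.1 + β * w.1 := rfl
  set x := α • u + β • w
  have h6 : α * x.1 + β * x.1 = x.1 := by rw [← add_mul, hαβ, one_mul]
  rw [h5] at h6 h3 ⊢
  nlinarith

lemma contDiffAt_specificEntropy (hh : IsSyngeEOS h) {u : State d} (hu : u ∈ admissible d h) :
    ContDiffAt ℝ 1 (specificEntropy h) u :=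
  ContDiffAt.comp (f := toPrim h) (g := primEntropy h) u
    (contDiffAt_primEntropy hh (toPrim_mem hu)) (contDiffAt_toPrim hh hu)

/-- Gibbs' relation. A differentiable function has the slope of any plane that touches its graph
from above. -/
lemma fst_mul_fderiv_specificEntropy (hh : IsSyngeEOS h) {u : State d}
    (hu : u ∈ admissible d h) :
    u.1 • fderiv ℝ (specificEntropy h) u = entropyGradient h u := by
  have hS := ((contDiffAt_specificEntropy hh hu).differentiableAt one_ne_zero).hasFDerivAt
  have hf := ((hasFDerivAt_fst (𝕜 := ℝ) (p := u)).mul (hS.sub_const (specificEntropy h u))).sub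
    ((entropyGradient h u).hasFDerivAt (x := u))
  have hmax : IsLocalMax (fun y : State d =>
      y.1 * (specificEntropy h y - specificEntropy h u) - entropyGradient h u y) u := by
    filter_upwards [(isOpen_admissible hh).mem_nhds hu] with y hy
    have h1 := specificEntropy_tangent hh hy hu
    have h2 := specificEntropy_tangent_self hu
    rw [sub_self, mul_zero]
    linarith
  have h0 := hmax.hasFDerivAt_eq_zero hf
  rw [sub_self, zero_smul, add_zero, sub_eq_zero] at h0
  exact h0

/-- The convex nonincreasing function `s ↦ ((s₀ - s)⁺)²`. -/
def cutoff (s₀ s : ℝ) : ℝ := max (s₀ - s) 0 ^ 2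

lemma cutoff_nonneg (s₀ s : ℝ) : 0 ≤ cutoff s₀ s := sq_nonneg _

lemma cutoff_eq_zero_iff {s₀ s : ℝ} : cutoff s₀ s = 0 ↔ s₀ ≤ s := by
  rw [cutoff, sq_eq_zero_iff, max_eq_right_iff, sub_nonpos]

lemma antitone_cutoff (s₀ : ℝ) : Antitone (cutoff s₀) := fun _ _ hst =>
  pow_le_pow_left₀ (le_max_right _ _) (max_le_max_right _ (by linarith)) 2

lemma convexOn_cutoff (s₀ : ℝ) : ConvexOn ℝ univ (cutoff s₀) := by
  refine ConvexOn.pow (ConvexOn.sup ?_ (convexOn_const 0 convex_univ)) (fun x _ => le_max_right _ _) 2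
  exact (convexOn_const s₀ convex_univ).sub (concaveOn_id convex_univ)

lemma hasDerivAt_cutoff (s₀ s : ℝ) : HasDerivAt (cutoff s₀) (-2 * max (s₀ - s) 0) s := by
  rcases lt_trichotomy s s₀ with hs | hs | hs
  · have h1 : HasDerivAt (fun s => (s₀ - s) ^ 2) (-2 * max (s₀ - s) 0) s := by
      have := ((hasDerivAt_id' s).const_sub s₀).fun_pow 2
      rw [max_eq_left (by linarith)]
      refine this.congr_deriv ?_
      norm_num
    refine h1.congr_of_eventuallyEq ?_
    filter_upwards [Iio_mem_nhds hs] with x hx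
    rw [cutoff, max_eq_left (by linarith [mem_Iio.1 hx])]
  · subst hs
    rw [sub_self, max_self, mul_zero]
    rw [hasDerivAt_iff_isLittleO]
    refine Asymptotics.IsBigO.trans_isLittleO (g := fun x => (x - s) ^ 2) ?_ ?_
    · refine Asymptotics.IsBigO.of_bound 1 (Eventually.of_forall fun x => ?_)
      simp only [cutoff, sub_self, max_self, smul_zero, sub_zero, norm_pow, one_mul, ne_eq,
        OfNat.ofNat_ne_zero, not_false_eq_true, zero_pow]
      refine pow_le_pow_left₀ (norm_nonneg _) ?_ 2
      rw [Real.norm_of_nonneg (le_max_right _ _), Real.norm_eq_abs, abs_sub_comm]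
      exact max_le (le_abs_self _) (abs_nonneg _)
    · have := Asymptotics.isLittleO_pow_sub_sub s (m := 2) (by norm_num)
      simpa using this
  · have h1 : HasDerivAt (fun _ : ℝ => (0 : ℝ)) (-2 * max (s₀ - s) 0) s := by
      rw [max_eq_right (by linarith), mul_zero]
      exact hasDerivAt_const s 0
    refine h1.congr_of_eventuallyEq ?_
    filter_upwards [Ioi_mem_nhds hs] with x hx
    exact cutoff_eq_zero_iff.2 (le_of_lt hx)

lemma contDiff_cutoff (s₀ : ℝ) : ContDiff ℝ 1 (cutoff s₀) := by
  rw [contDiff_one_iff_deriv]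
  refine ⟨fun s => (hasDerivAt_cutoff s₀ s).differentiableAt, ?_⟩
  have : deriv (cutoff s₀) = fun s => -2 * max (s₀ - s) 0 :=
    funext fun s => (hasDerivAt_cutoff s₀ s).deriv
  rw [this]
  fun_prop

/-- The mathematical entropy `D ((s₀ - S)⁺)²`, which vanishes exactly where `S ≥ s₀`. -/
def cutEntropy (h : ℝ → ℝ) (s₀ : ℝ) (u : State d) : ℝ := u.1 * cutoff s₀ (specificEntropy h u)

/-- The flux of the mathematical entropy `cutEntropy`. -/
def cutEntropyFlux (h : ℝ → ℝ) (s₀ : ℝ) (i : Fin d) (u : State d) : ℝ :=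
  velocity h u i * cutEntropy h s₀ u

lemma cutEntropy_nonneg (s₀ : ℝ) {u : State d} (hu : u ∈ admissible d h) :
    0 ≤ cutEntropy h s₀ u := mul_nonneg (fst_pos_of_mem hu).le (cutoff_nonneg _ _)

lemma cutEntropy_eq_zero_iff {s₀ : ℝ} {u : State d} (hu : u ∈ admissible d h) :
    cutEntropy h s₀ u = 0 ↔ s₀ ≤ specificEntropy h u := by
  rw [cutEntropy, mul_eq_zero, cutoff_eq_zero_iff, or_iff_right (fst_pos_of_mem hu).ne']

lemma contDiffAt_cutEntropy (hh : IsSyngeEOS h) (s₀ : ℝ) {u : State d}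
    (hu : u ∈ admissible d h) : ContDiffAt ℝ 1 (cutEntropy h s₀) u :=
  contDiff_fst.contDiffAt.mul
    ((contDiff_cutoff s₀).contDiffAt.comp u (contDiffAt_specificEntropy hh hu))

lemma contDiffAt_velocity (hh : IsSyngeEOS h) {u : State d} (hu : u ∈ admissible d h) :
    ContDiffAt ℝ 1 (velocity h) u :=
  (contDiff_fst.comp contDiff_snd).contDiffAt.comp u (contDiffAt_toPrim hh hu)

lemma contDiffAt_velocity_apply (hh : IsSyngeEOS h) {u : State d} (hu : u ∈ admissible d h)
    (i : Fin d) : ContDiffAt ℝ 1 (fun u => velocity h u i) u :=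
  (EuclideanSpace.proj i : Space d →L[ℝ] ℝ).contDiff.contDiffAt.comp u
    (contDiffAt_velocity hh hu)

/-- `(D, σ) ↦ D φ(σ / D)` is jointly convex, and nonincreasing in `σ`, for a convex and
nonincreasing `φ`; hence its composition with the concave `σ = D S` is convex. -/
lemma convexOn_cutEntropy (hh : IsSyngeEOS h) (s₀ : ℝ) :
    ConvexOn ℝ (admissible d h) (cutEntropy h s₀) := by
  refine ⟨convex_admissible hh, fun u hu w hw α β hα hβ hαβ => ?_⟩
  have hx := convex_admissible hh hu hw hα hβ hαβ
  have hc := specificEntropy_concave hh hu hw hα hβ hαβ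
  have hxD := fst_pos_of_mem hx
  have hD : (α • u + β • w).1 = α * u.1 + β * w.1 := rfl
  have hu0 := fst_pos_of_mem hu
  have hw0 := fst_pos_of_mem hw
  simp only [cutEntropy, smul_eq_mul]
  set x := α • u + β • w
  have hsum : α * u.1 / x.1 + β * w.1 / x.1 = 1 := by
    rw [← add_div, ← hD, div_self hxD.ne']
  have hle : α * u.1 / x.1 * specificEntropy h u + β * w.1 / x.1 * specificEntropy h w
      ≤ specificEntropy h x := by
    rw [div_mul_eq_mul_div, div_mul_eq_mul_div, ← add_div, div_le_iff₀ hxD]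
    linarith
  have h1 := antitone_cutoff s₀ hle
  have h2 := (convexOn_cutoff s₀).2 (mem_univ (specificEntropy h u))
    (mem_univ (specificEntropy h w)) (div_nonneg (mul_nonneg hα hu0.le) hxD.le)
    (div_nonneg (mul_nonneg hβ hw0.le) hxD.le) hsum
  simp only [smul_eq_mul] at h2
  have h3 := mul_le_mul_of_nonneg_left (h1.trans h2) hxD.le
  refine h3.trans (le_of_eq ?_)
  field_simp

lemma fderiv_cutEntropy (hh : IsSyngeEOS h) (s₀ : ℝ) {u : State d} (hu : u ∈ admissible d h)
    (w : State d) : fderiv ℝ (cutEntropy h s₀) u w = cutoff s₀ (specificEntropy h u) * w.1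
      + -2 * max (s₀ - specificEntropy h u) 0 * entropyGradient h u w := by
  have hS := ((contDiffAt_specificEntropy hh hu).differentiableAt one_ne_zero).hasFDerivAt
  have hf := (hasFDerivAt_fst (𝕜 := ℝ) (p := u)).mul
    ((hasDerivAt_cutoff s₀ (specificEntropy h u)).comp_hasFDerivAt u hS)
  have hf' : fderiv ℝ (cutEntropy h s₀) u = _ := hf.fderiv
  rw [hf', ← fst_mul_fderiv_specificEntropy hh hu]
  simp
  ring

/-- The derivative of the flux in terms of the variations `z` of the primitive variables. -/
lemma fderiv_flux_apply (hh : IsSyngeEOS h) {u : State d} (hu : u ∈ admissible d h) (i : Fin d)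
    (w : State d) : fderiv ℝ (flux h i) u w =
      (u.1 * (fderiv ℝ (toPrim h) u w).2.1 i + velocity h u i * w.1,
        velocity h u i • w.2.1 + (fderiv ℝ (toPrim h) u w).2.1 i • u.2.1
          + (fderiv ℝ (toPrim h) u w).2.2 • EuclideanSpace.single i (1 : ℝ), w.2.1 i) := by
  have hP := ((contDiffAt_toPrim hh hu).differentiableAt one_ne_zero).hasFDerivAt
  have hv : HasFDerivAt (fun u => velocity h u i)
      ((EuclideanSpace.proj i : Space d →L[ℝ] ℝ).comp
        ((ContinuousLinearMap.fst ℝ (Space d) ℝ).comp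
          ((ContinuousLinearMap.snd ℝ ℝ (Space d × ℝ)).comp (fderiv ℝ (toPrim h) u)))) u :=
    (EuclideanSpace.proj i : Space d →L[ℝ] ℝ).hasFDerivAt.comp u hP.snd.fst
  have hp : HasFDerivAt (fun u => pressure h u) _ u := hP.snd.snd
  have h1 : HasFDerivAt (fun u : State d => u.1) _ u := hasFDerivAt_fst (𝕜 := ℝ) (p := u)
  have h2 : HasFDerivAt (fun u : State d => u.2.1) _ u := (hasFDerivAt_snd (𝕜 := ℝ) (p := u)).fst
  have h3 : HasFDerivAt (fun u : State d => u.2.1 i)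
      ((EuclideanSpace.proj i : Space d →L[ℝ] ℝ).comp
        ((ContinuousLinearMap.fst ℝ (Space d) ℝ).comp
          (ContinuousLinearMap.snd ℝ ℝ (Space d × ℝ)))) u :=
    (EuclideanSpace.proj i : Space d →L[ℝ] ℝ).hasFDerivAt.comp u h2
  have hF := (h1.mul hv).prodMk (((hv.smul h2).add
    (hp.smul_const (EuclideanSpace.single i (1 : ℝ)))).prodMk h3)
  have hF' : fderiv ℝ (flux h i) u = _ := hF.fderiv
  rw [hF']
  simp

/-- The relations of `fderiv_toCons_relations` along a variation of the conservative variables. -/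
lemma fderiv_toPrim_relations (hh : IsSyngeEOS h) {u : State d} (hu : u ∈ admissible d h)
    (w : State d) :
    u.1 * w.1 * (1 - ‖velocity h u‖ ^ 2)
      - u.1 ^ 2 * inner ℝ (velocity h u) (fderiv ℝ (toPrim h) u w).2.1
      = density h u * (fderiv ℝ (toPrim h) u w).1 ∧
    w.2.1 = (w.2.2 + (fderiv ℝ (toPrim h) u w).2.2) • velocity h u
      + (u.2.2 + pressure h u) • (fderiv ℝ (toPrim h) u w).2.1 ∧
    w.2.2 - inner ℝ w.2.1 (velocity h u) - inner ℝ u.2.1 (fderiv ℝ (toPrim h) u w).2.1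
      = (h (theta h u) - theta h u) * (fderiv ℝ (toPrim h) u w).1
        + (deriv h (theta h u) - 1)
          * ((fderiv ℝ (toPrim h) u w).2.2 - theta h u * (fderiv ℝ (toPrim h) u w).1) := by
  have := fderiv_toCons_relations hh (toPrim_mem hu) (fderiv ℝ (toPrim h) u w)
  rwa [fderiv_toCons_fderiv_toPrim hh hu, toCons_toPrim hu] at this

lemma toPrim_relations {u : State d} (hu : u ∈ admissible d h) :
    u.1 = density h u * lorentz (velocity h u) ∧
    u.2.1 = (u.2.2 + pressure h u) • velocity h u ∧
    u.2.2 - inner ℝ u.2.1 (velocity h u) = density h u * (h (theta h u) - theta h u) := by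
  have := toCons_relations (h := h) (toPrim_mem hu)
  rw [toCons_toPrim hu] at this
  refine ⟨?_, this.2⟩
  conv_lhs => rw [← toCons_toPrim hu]
  rfl

lemma pressure_eq {u : State d} (hu : u ∈ admissible d h) :
    pressure h u = density h u * theta h u := by
  have : 0 < density h u := (toPrim_mem hu).1
  rw [theta]; field_simp

lemma theta_pos {u : State d} (hu : u ∈ admissible d h) : 0 < theta h u :=
  div_pos (toPrim_mem hu).2.1 (toPrim_mem hu).1

/-- The specific entropy is transported with the fluid velocity: `dS ∘ dF_i = v_i dS`. -/
lemma entropyGradient_flux (hh : IsSyngeEOS h) {u : State d} (hu : u ∈ admissible d h)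
    (i : Fin d) (w : State d) :
    entropyGradient h u (fderiv ℝ (flux h i) u w) = velocity h u i * entropyGradient h u w := by
  obtain ⟨-, r2, -⟩ := fderiv_toPrim_relations hh hu w
  obtain ⟨s1, s2, s3⟩ := toPrim_relations hu
  have hp := pressure_eq hu
  have r2i := congrArg (fun x : Space d => x i) r2
  simp only [PiLp.add_apply, PiLp.smul_apply, smul_eq_mul] at r2i
  rw [fderiv_flux_apply hh hu, entropyGradient_apply, entropyGradient_apply]
  simp only [inner_add_right, inner_smul_right]
  have e1 : inner ℝ (velocity h u) (EuclideanSpace.single i (1 : ℝ)) = velocity h u i := by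
    rw [EuclideanSpace.inner_single_right]; simp
  rw [e1]
  rw [real_inner_comm] at s3
  generalize inner ℝ (velocity h u) w.2.1 = a at *
  generalize inner ℝ (velocity h u) u.2.1 = b at *
  generalize (fderiv ℝ (toPrim h) u w).2.1 i = v' at *
  generalize (fderiv ℝ (toPrim h) u w).2.2 = p' at *
  rw [r2i, s1]
  field_simp
  have hb : b = u.2.2 - density h u * (h (theta h u) - theta h u) := by linarith
  rw [hb, hp]
  ring

lemma isConvexEntropyPair_cutEntropy (hh : IsSyngeEOS h) (s₀ : ℝ) :
    IsConvexEntropyPair (d := d) h (cutEntropy h s₀) (cutEntropyFlux h s₀) where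
  contDiffOn_entropy := fun _ hu => (contDiffAt_cutEntropy hh s₀ hu).contDiffWithinAt
  contDiffOn_flux := fun i _ hu =>
    ((contDiffAt_velocity_apply hh hu i).mul (contDiffAt_cutEntropy hh s₀ hu)).contDiffWithinAt
  convexOn := convexOn_cutEntropy hh s₀
  compatible := by
    intro i u hu
    refine ContinuousLinearMap.ext fun w => ?_
    have hP := ((contDiffAt_toPrim hh hu).differentiableAt one_ne_zero).hasFDerivAt
    have hv : HasFDerivAt (fun u => velocity h u i)
        ((EuclideanSpace.proj i : Space d →L[ℝ] ℝ).comp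
          ((ContinuousLinearMap.fst ℝ (Space d) ℝ).comp
            ((ContinuousLinearMap.snd ℝ ℝ (Space d × ℝ)).comp (fderiv ℝ (toPrim h) u)))) u :=
      (EuclideanSpace.proj i : Space d →L[ℝ] ℝ).hasFDerivAt.comp u hP.snd.fst
    have hη := ((contDiffAt_cutEntropy hh s₀ hu).differentiableAt one_ne_zero).hasFDerivAt
    have hq : fderiv ℝ (cutEntropyFlux h s₀ i) u = _ := (hv.mul hη).fderiv
    have hproj : ∀ x : Space d, (EuclideanSpace.proj i : Space d →L[ℝ] ℝ) x = x i := fun _ => rfl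
    rw [hq, ContinuousLinearMap.comp_apply, fderiv_cutEntropy hh s₀ hu (fderiv ℝ (flux h i) u w),
      entropyGradient_flux hh hu]
    simp only [add_apply, smul_apply, smul_eq_mul,
      fderiv_cutEntropy hh s₀ hu w, fderiv_flux_apply hh hu i w, ContinuousLinearMap.comp_apply,
      ContinuousLinearMap.coe_fst', ContinuousLinearMap.coe_snd', hproj,
      cutEntropy]
    ring

/-- The action of the Jacobian in the direction `n`. -/
lemma sum_smul_fderiv_flux_apply (hh : IsSyngeEOS h) {u : State d} (hu : u ∈ admissible d h)
    (n : Space d) (w : State d) :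
    (∑ i, n i • fderiv ℝ (flux h i) u : State d →L[ℝ] State d) w =
      (u.1 * inner ℝ n (fderiv ℝ (toPrim h) u w).2.1 + inner ℝ n (velocity h u) * w.1,
        inner ℝ n (velocity h u) • w.2.1 + inner ℝ n (fderiv ℝ (toPrim h) u w).2.1 • u.2.1
          + (fderiv ℝ (toPrim h) u w).2.2 • n, inner ℝ n w.2.1) := by
  have hin : ∀ x : Space d, inner ℝ n x = ∑ i, n i * x i := by
    intro x
    simp [PiLp.inner_apply, mul_comm]
  have hn : ∑ i, n i • EuclideanSpace.single i (1 : ℝ) = n := by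
    ext j
    simp [Pi.single_apply]
  simp only [sum_apply, smul_apply, fderiv_flux_apply hh hu]
  refine Prod.ext ?_ (Prod.ext ?_ ?_)
  · simp only [Prod.fst_sum, Prod.smul_fst, smul_eq_mul, mul_add, Finset.sum_add_distrib, hin,
      Finset.mul_sum, Finset.sum_mul]
    congr 1 <;> exact Finset.sum_congr rfl fun i _ => by ring
  · simp only [Prod.snd_sum, Prod.fst_sum, Prod.smul_fst, Prod.smul_snd, smul_add,
      Finset.sum_add_distrib, hin, Finset.sum_smul, smul_smul]
    congr 1
    conv_rhs => rw [← hn, Finset.smul_sum]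
    exact Finset.sum_congr rfl fun i _ => by rw [smul_smul, mul_comm]
  · simp only [Prod.snd_sum, Prod.smul_snd, smul_eq_mul, hin]

/-- The normal velocity is a characteristic speed: the eigenvector is the variation of the
density at fixed velocity and pressure. -/
lemma isCharSpeed_inner (hh : IsSyngeEOS h) {u : State d} (hu : u ∈ admissible d h)
    {n : Space d} (hn : ‖n‖ = 1) : IsCharSpeed h u (inner ℝ n (velocity h u)) := by
  refine ⟨n, hn, ?_⟩
  obtain ⟨w, hw⟩ : ∃ w, fderiv ℝ (toPrim h) u w = ((1, 0, 0) : Prim d) :=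
    ⟨_, fderiv_toPrim_fderiv_toCons hh hu _⟩
  refine Module.End.hasEigenvalue_of_hasEigenvector (x := w) ?_
  rw [Module.End.hasEigenvector_iff, Module.End.mem_eigenspace_iff]
  constructor
  · refine (sum_smul_fderiv_flux_apply hh hu n w).trans ?_
    have r2 := (fderiv_toPrim_relations hh hu w).2.1
    rw [hw] at r2 ⊢
    simp only [add_zero, smul_zero] at r2
    refine Prod.ext ?_ (Prod.ext ?_ ?_)
    · simp
    · simp
    · simp only [Prod.smul_snd, smul_eq_mul]
      rw [r2, inner_smul_right, mul_comm]
  · rintro rfl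
    rw [map_zero] at hw
    exact one_ne_zero (congrArg Prod.fst hw).symm

/-- In a fluid at rest, the speed of sound is a positive characteristic speed. -/
lemma exists_isCharSpeed_pos (hh : IsSyngeEOS h) {u : State d} (hu : u ∈ admissible d h)
    (hv : velocity h u = 0) {n : Space d} (hn : ‖n‖ = 1) : ∃ c, 0 < c ∧ IsCharSpeed h u c := by
  have hθ := theta_pos hu
  have hg := hh.pos _ hθ
  have hd := hh.one_lt_deriv hθ
  have hρ : 0 < density h u := (toPrim_mem hu).1
  set θ := theta h u with hθdef
  have hH : 0 < h θ := by linarith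
  have hd1 : 0 < deriv h θ - 1 := by linarith
  obtain ⟨c, hc⟩ : ∃ c, c = √(θ * deriv h θ / ((deriv h θ - 1) * h θ)) := ⟨_, rfl⟩
  have hcpos : 0 < θ * deriv h θ / ((deriv h θ - 1) * h θ) := by positivity
  have hc2 : c ^ 2 = θ * deriv h θ / ((deriv h θ - 1) * h θ) := by rw [hc, Real.sq_sqrt hcpos.le]
  have hc0 : 0 < c := by rw [hc]; exact Real.sqrt_pos.2 hcpos
  refine ⟨c, hc0, n, hn, ?_⟩
  obtain ⟨w, hw⟩ : ∃ w, fderiv ℝ (toPrim h) u w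
      = ((density h u, c • n, c ^ 2 * (density h u * h θ)) : Prim d) :=
    ⟨_, fderiv_toPrim_fderiv_toCons hh hu _⟩
  refine Module.End.hasEigenvalue_of_hasEigenvector (x := w) ?_
  rw [Module.End.hasEigenvector_iff, Module.End.mem_eigenspace_iff]
  constructor
  · refine (sum_smul_fderiv_flux_apply hh hu n w).trans ?_
    obtain ⟨r1, r2, r3⟩ := fderiv_toPrim_relations hh hu w
    obtain ⟨s1, s2, s3⟩ := toPrim_relations hu
    have hp := pressure_eq hu
    rw [hw, hv] at r1 r2 r3
    rw [hv] at s1 s2 s3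
    rw [smul_zero] at s2
    simp only [s2, lorentz, norm_zero, inner_zero_left, inner_zero_right, smul_zero, zero_add,
      mul_zero, sub_zero, ne_eq, OfNat.ofNat_ne_zero, not_false_eq_true, zero_pow, Real.sqrt_one,
      inv_one, mul_one, ← hθdef] at r1 r2 r3 s1 s3
    rw [s1] at r1
    have hw1 : w.1 = density h u := mul_left_cancel₀ hρ.ne' r1
    have hEp : u.2.2 + pressure h u = density h u * h θ := by rw [s3, hp]; ring
    have hw3 : w.2.2 = density h u * h θ := by
      rw [r3, hc2]; field_simp; ring
    rw [hw, hv, s2, s1]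
    have hnn : inner ℝ n n = (1 : ℝ) := by rw [real_inner_self_eq_norm_sq, hn, one_pow]
    refine Prod.ext ?_ (Prod.ext ?_ ?_)
    · simp only [inner_zero_right, zero_mul, add_zero, inner_smul_right, hnn, Prod.smul_fst,
        smul_eq_mul, hw1]
      ring
    · simp only [inner_zero_right, zero_smul, smul_zero, zero_add, add_zero, Prod.smul_snd,
        Prod.smul_fst]
      rw [r2, hEp, smul_smul, smul_smul]
      congr 1; ring
    · simp only [Prod.smul_snd, smul_eq_mul]
      rw [r2, hEp, hw3, inner_smul_right, inner_smul_right, hnn]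
      ring
  · rintro rfl
    rw [map_zero] at hw
    exact hρ.ne (congrArg Prod.fst hw)

/-- A bound of the characteristic speeds at a state is positive and bounds the velocity. -/
lemma norm_velocity_le_of_forall_isCharSpeed (hd : 0 < d) (hh : IsSyngeEOS h) {u : State d}
    (hu : u ∈ admissible d h) {vmax : ℝ} (hb : ∀ c, IsCharSpeed h u c → |c| ≤ vmax) :
    ‖velocity h u‖ ≤ vmax ∧ 0 < vmax := by
  rcases eq_or_ne (velocity h u) 0 with hv | hv
  · have hn : ‖(EuclideanSpace.single ⟨0, hd⟩ (1 : ℝ) : Space d)‖ = 1 := by simp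
    obtain ⟨c, hc, hc'⟩ := exists_isCharSpeed_pos hh hu hv hn
    have := hb c hc'
    rw [abs_of_pos hc] at this
    rw [hv, norm_zero]
    constructor <;> linarith
  · have hpos := norm_pos_iff.2 hv
    have hn : ‖(‖velocity h u‖⁻¹ • velocity h u : Space d)‖ = 1 := norm_smul_inv_norm hv
    have := hb _ (isCharSpeed_inner hh hu hn)
    rw [inner_smul_left, real_inner_self_eq_norm_sq] at this
    simp only [map_inv₀, conj_trivial] at this
    rw [pow_two, inv_mul_cancel_left₀ hpos.ne', abs_of_pos hpos] at this
    exact ⟨this, hpos.trans_le this⟩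

end

end RelEuler

/-! ### Distributional monotonicity in time -/

namespace RelEuler

noncomputable section

/-- The primitive of a normalized bump function, a smooth step from `0` to `1`. -/
def smoothStep (φ : ContDiffBump (0 : ℝ)) (t : ℝ) : ℝ := ∫ y in (-φ.rOut)..t, φ.normed volume y

section SmoothStep

variable (φ : ContDiffBump (0 : ℝ))

lemma normed_eq_zero_of_rOut_le {y : ℝ} (hy : φ.rOut ≤ |y|) : φ.normed volume y = 0 := by
  rw [← Function.notMem_support, φ.support_normed_eq]
  simpa using hy

lemma hasDerivAt_smoothStep (t : ℝ) : HasDerivAt (smoothStep φ) (φ.normed volume t) t :=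
  intervalIntegral.integral_hasDerivAt_right (φ.continuous_normed.intervalIntegrable _ _)
    (φ.continuous_normed.stronglyMeasurableAtFilter _ _) φ.continuous_normed.continuousAt

lemma deriv_smoothStep : deriv (smoothStep φ) = φ.normed volume :=
  funext fun t => (hasDerivAt_smoothStep φ t).deriv

lemma contDiff_smoothStep : ContDiff ℝ ∞ (smoothStep φ) := by
  rw [contDiff_infty_iff_deriv, deriv_smoothStep]
  exact ⟨fun t => (hasDerivAt_smoothStep φ t).differentiableAt, φ.contDiff_normed⟩

lemma monotone_smoothStep : Monotone (smoothStep φ) :=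
  monotone_of_deriv_nonneg (fun t => (hasDerivAt_smoothStep φ t).differentiableAt) fun t => by
    rw [deriv_smoothStep]; exact φ.nonneg_normed t

lemma smoothStep_of_le {t : ℝ} (ht : t ≤ -φ.rOut) : smoothStep φ t = 0 := by
  rw [smoothStep, intervalIntegral.integral_congr (g := fun _ => 0), intervalIntegral.integral_zero]
  intro y hy
  rw [uIcc_of_ge ht] at hy
  refine normed_eq_zero_of_rOut_le φ ?_
  rw [abs_of_nonpos (by linarith [hy.2, φ.rOut_pos])]
  linarith [hy.2]

lemma smoothStep_of_ge {t : ℝ} (ht : φ.rOut ≤ t) : smoothStep φ t = 1 := by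
  rw [smoothStep, intervalIntegral.integral_eq_integral_of_support_subset, φ.integral_normed]
  rw [φ.support_normed_eq, Real.ball_eq_Ioo, zero_sub, zero_add]
  exact fun y hy => ⟨hy.1, (hy.2.trans_le ht).le⟩

end SmoothStep

/-- Bump functions with radii shrinking to zero. -/
def shrinkingBump (n : ℕ) : ContDiffBump (0 : ℝ) where
  rIn := 1 / 2 * (1 / ((n : ℝ) + 1))
  rOut := 1 / ((n : ℝ) + 1)
  rIn_pos := by positivity
  rIn_lt_rOut := by
    have : (0 : ℝ) < 1 / ((n : ℝ) + 1) := by positivity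
    linarith

lemma tendsto_rOut_shrinkingBump : Tendsto (fun n => (shrinkingBump n).rOut) atTop (𝓝 0) :=
  tendsto_one_div_add_atTop_nhds_zero_nat

/-- A function `I` on `[0, T)` with `I' ≤ 0` in the sense of distributions, the initial value
included, is nonincreasing outside a null set of positive times. -/
theorem exists_null_forall_le_of_distributional {T : ℝ} {I : ℝ → ℝ}
    (hI : ∀ B < T, IntegrableOn I (Ioo 0 B))
    (hineq : ∀ a : ℝ → ℝ, ContDiff ℝ ∞ a → (∀ t, 0 ≤ a t) →
      (∃ A, ∃ B < T, ∀ t, t ∉ Icc A B → a t = 0) →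
      0 ≤ (∫ t in Ioo 0 T, deriv a t * I t) + a 0 * I 0) :
    ∃ N : Set ℝ, volume N = 0 ∧ 0 ∉ N ∧
      ∀ t₁ t₂ : ℝ, 0 ≤ t₁ → t₁ < t₂ → t₂ < T → t₁ ∉ N → t₂ ∉ N → I t₂ ≤ I t₁ := by
  let B : ℕ → ℝ := fun m => T - 1 / ((m : ℝ) + 1)
  have hB : ∀ m, B m < T := fun m => by
    have : (0 : ℝ) < 1 / ((m : ℝ) + 1) := by positivity
    simp only [B]; linarith
  let g : ℕ → ℝ → ℝ := fun m => (Ioo 0 (B m)).indicator I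
  have hg : ∀ m, Integrable (g m) := fun m =>
    (integrable_indicator_iff measurableSet_Ioo).2 (hI (B m) (hB m))
  let conv : ℕ → ℕ → ℝ → ℝ := fun m n s =>
    ∫ t, (shrinkingBump n).normed volume (t - s) * g m t
  have hconv : ∀ m, ∀ᵐ s, Tendsto (fun n => conv m n s) atTop (𝓝 (g m s)) := by
    intro m
    have := ContDiffBump.ae_convolution_tendsto_right_of_locallyIntegrable
      (μ := (volume : Measure ℝ)) (φ := shrinkingBump) (K := 2) tendsto_rOut_shrinkingBump
      (Eventually.of_forall fun n => by simp [shrinkingBump]) (hg m).locallyIntegrable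
    filter_upwards [this] with s hs
    refine hs.congr fun n => ?_
    rw [MeasureTheory.convolution_eq_swap]
    refine integral_congr_ae (Eventually.of_forall fun t => ?_)
    simp only [ContinuousLinearMap.lsmul_apply, smul_eq_mul]
    rw [← ContDiffBump.normed_neg, neg_sub]
  let N : Set ℝ := {s | ¬ ∀ m, Tendsto (fun n => conv m n s) atTop (𝓝 (g m s))} ∩ Ioi 0
  refine ⟨N, ?_, fun h0 => lt_irrefl (0 : ℝ) h0.2, ?_⟩
  · exact measure_mono_null inter_subset_left (ae_iff.1 (ae_all_iff.2 hconv))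
  intro t₁ t₂ h1 h12 h2 hN1 hN2
  have ht2 : 0 < t₂ := h1.trans_lt h12
  have hlim : ∀ t, 0 < t → t ∉ N → ∀ m, Tendsto (fun n => conv m n t) atTop (𝓝 (g m t)) := by
    intro t ht htN
    by_contra hc
    exact htN ⟨hc, ht⟩
  obtain ⟨m, hm⟩ : ∃ m, t₂ < B m := by
    obtain ⟨m, hm⟩ := exists_nat_one_div_lt (sub_pos.2 h2)
    exact ⟨m, by simp only [B]; linarith⟩
  have hgm : ∀ t, 0 < t → t ≤ t₂ → g m t = I t := fun t h3 h4 =>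
    indicator_of_mem (show t ∈ Ioo 0 (B m) from ⟨h3, h4.trans_lt hm⟩) I
  -- the inequality tested with the difference of the smooth steps at `s` and `t₂`
  have htest : ∀ s < t₂, ∀ᶠ n in atTop,
      0 ≤ conv m n s - conv m n t₂
        + (smoothStep (shrinkingBump n) (0 - s) - smoothStep (shrinkingBump n) (0 - t₂)) * I 0 := by
    intro s hs
    filter_upwards [tendsto_rOut_shrinkingBump.eventually_lt_const (sub_pos.2 hm)] with n hn
    set φ := shrinkingBump n
    let a : ℝ → ℝ := fun t => smoothStep φ (t - s) - smoothStep φ (t - t₂)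
    have ha : ContDiff ℝ ∞ a :=
      ((contDiff_smoothStep φ).comp (contDiff_id.sub contDiff_const)).sub
        ((contDiff_smoothStep φ).comp (contDiff_id.sub contDiff_const))
    have hda : ∀ t, deriv a t = φ.normed volume (t - s) - φ.normed volume (t - t₂) := fun t =>
      (((hasDerivAt_smoothStep φ (t - s)).comp_sub_const t s).fun_sub
        ((hasDerivAt_smoothStep φ (t - t₂)).comp_sub_const t t₂)).deriv
    have hkey := hineq a ha (fun t => sub_nonneg.2 (monotone_smoothStep φ (by linarith)))
      ⟨s - φ.rOut, B m, hB m, fun t ht => by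
        rw [mem_Icc, not_and_or, not_le, not_le] at ht
        rcases ht with ht | ht
        · simp only [a]
          rw [smoothStep_of_le φ (by linarith), smoothStep_of_le φ (by linarith), sub_zero]
        · simp only [a]
          rw [smoothStep_of_ge φ (by linarith), smoothStep_of_ge φ (by linarith), sub_self]⟩
    have hint : ∀ r, Integrable (fun t => φ.normed volume (t - r) * g m t) := by
      intro r
      refine (hg m).bdd_mul (c := 1 / (volume (Metric.closedBall (0 : ℝ) φ.rIn)).toReal) ?_ ?_
      · exact (φ.continuous_normed.comp (continuous_id.sub continuous_const)).aestronglyMeasurable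
      · refine Eventually.of_forall fun t => ?_
        rw [Real.norm_of_nonneg (φ.nonneg_normed _)]
        exact φ.normed_le_div_measure_closedBall_rIn volume _
    have hEq : ∫ t in Ioo 0 T, deriv a t * I t = conv m n s - conv m n t₂ := by
      simp only [conv]
      rw [← integral_sub (hint s) (hint t₂), ← integral_indicator measurableSet_Ioo]
      refine integral_congr_ae (Eventually.of_forall fun t => ?_)
      dsimp only
      rw [← sub_mul, ← hda t]
      by_cases ht : t ∈ Ioo 0 (B m)
      · rw [indicator_of_mem (show t ∈ Ioo 0 T from ⟨ht.1, ht.2.trans (hB m)⟩)]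
        simp only [g]
        rw [indicator_of_mem ht]
      · simp only [g]
        rw [indicator_of_notMem ht, mul_zero]
        by_cases htT : t ∈ Ioo 0 T
        · rw [indicator_of_mem htT, hda t]
          have htB : B m ≤ t := by
            by_contra hc
            exact ht ⟨htT.1, not_le.1 hc⟩
          rw [normed_eq_zero_of_rOut_le φ (by rw [abs_of_nonneg] <;> linarith),
            normed_eq_zero_of_rOut_le φ (by rw [abs_of_nonneg] <;> linarith), sub_zero, zero_mul]
        · rw [indicator_of_notMem htT]
    rw [hEq] at hkey
    exact hkey
  have hlim2 := hlim t₂ ht2 hN2 m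
  rw [hgm t₂ ht2 le_rfl] at hlim2
  have hsmall : ∀ r : ℝ, 0 < r → ∀ᶠ n in atTop, (shrinkingBump n).rOut < r := fun r hr =>
    tendsto_rOut_shrinkingBump.eventually_lt_const hr
  rcases h1.eq_or_lt with rfl | h1
  · -- at the initial time the first step is placed at `-1`, outside the time domain
    refine le_of_tendsto hlim2 ?_
    filter_upwards [htest (-1) (by linarith), hsmall 1 one_pos, hsmall t₂ ht2] with n hn h3 h4
    rw [smoothStep_of_ge _ (by linarith), smoothStep_of_le _ (by linarith)] at hn
    have h5 : conv m n (-1) = 0 := by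
      simp only [conv]
      refine integral_eq_zero_of_ae (Eventually.of_forall fun t => ?_)
      dsimp only
      by_cases ht : t ∈ Ioo 0 (B m)
      · rw [normed_eq_zero_of_rOut_le _ (by rw [abs_of_nonneg] <;> linarith [ht.1]), zero_mul, Pi.zero_apply]
      · simp only [g]
        rw [indicator_of_notMem ht, mul_zero, Pi.zero_apply]
    rw [h5] at hn
    linarith
  · have hlim1 := hlim t₁ h1 hN1 m
    rw [hgm t₁ h1 h12.le] at hlim1
    refine le_of_tendsto_of_tendsto hlim2 hlim1 ?_
    filter_upwards [htest t₁ h12, hsmall t₁ h1] with n hn h3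
    rw [smoothStep_of_le _ (by linarith), smoothStep_of_le _ (by linarith)] at hn
    linarith

end

end RelEuler

/-! ### The entropy in light cones -/

namespace RelEuler

noncomputable section

variable {d : ℕ} {h : ℝ → ℝ}

/-- A smooth weight of `(t, x)` supported in the truncated light cone
`|x - c| < k - vmax t`; the parameter `δ` smoothens its tip. -/
def coneWeight (vmax : ℝ) (c : Space d) (k δ : ℝ) (z : ℝ × Space d) : ℝ :=
  Real.smoothTransition (k - vmax * z.1 - √(δ ^ 2 + ‖z.2 - c‖ ^ 2))

section ConeWeight

variable {vmax : ℝ} {c : Space d} {k δ : ℝ}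

lemma contDiff_coneWeight (hδ : 0 < δ) : ContDiff ℝ ∞ (coneWeight vmax c k δ) := by
  refine Real.smoothTransition.contDiff.comp ?_
  refine (contDiff_const.sub (contDiff_const.mul contDiff_fst)).sub (ContDiff.sqrt ?_ ?_)
  · exact contDiff_const.add ((contDiff_snd.sub contDiff_const).norm_sq ℝ)
  · intro z; positivity

lemma coneWeight_nonneg (z : ℝ × Space d) : 0 ≤ coneWeight vmax c k δ z :=
  Real.smoothTransition.nonneg _

lemma coneWeight_eq_zero {z : ℝ × Space d} (hz : k - vmax * z.1 ≤ ‖z.2 - c‖) :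
    coneWeight vmax c k δ z = 0 := by
  refine Real.smoothTransition.zero_of_nonpos ?_
  have : ‖z.2 - c‖ ≤ √(δ ^ 2 + ‖z.2 - c‖ ^ 2) := Real.le_sqrt_of_sq_le (by nlinarith [sq_nonneg δ])
  linarith

lemma coneWeight_pos (hδ : 0 < δ) {z : ℝ × Space d} (hz : ‖z.2 - c‖ + δ < k - vmax * z.1) :
    0 < coneWeight vmax c k δ z := by
  refine Real.smoothTransition.pos_of_pos ?_
  have : √(δ ^ 2 + ‖z.2 - c‖ ^ 2) ≤ ‖z.2 - c‖ + δ := by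
    rw [Real.sqrt_le_iff]
    exact ⟨by positivity, by nlinarith [norm_nonneg (z.2 - c)]⟩
  linarith

/-- The weight decreases along curves of speed at most `vmax`. -/
lemma fderiv_coneWeight_le (hδ : 0 < δ) (z : ℝ × Space d) {v : Space d} (hv : ‖v‖ ≤ vmax) :
    fderiv ℝ (coneWeight vmax c k δ) z (1, v) ≤ 0 := by
  have hanti : Antitone fun s : ℝ => coneWeight vmax c k δ (z + s • ((1, v) : ℝ × Space d)) := by
    intro s s' hs
    refine Real.smoothTransition.monotone ?_
    simp only [Prod.fst_add, Prod.snd_add, Prod.smul_mk, smul_eq_mul, mul_one]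
    set y := z.2 + s • v - c with hy
    have hy' : z.2 + s' • v - c = y + (s' - s) • v := by rw [hy]; module
    have h0 : 0 ≤ (s' - s) * vmax := mul_nonneg (by linarith) ((norm_nonneg v).trans hv)
    have h2 : √(δ ^ 2 + ‖y‖ ^ 2) ≤ √(δ ^ 2 + ‖y + (s' - s) • v‖ ^ 2) + (s' - s) * vmax := by
      have h3 : ‖y‖ ≤ ‖y + (s' - s) • v‖ + (s' - s) * vmax := by
        have := norm_sub_le (y + (s' - s) • v) ((s' - s) • v)
        rw [add_sub_cancel_right, norm_smul, Real.norm_of_nonneg (by linarith)] at this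
        have := mul_le_mul_of_nonneg_left hv (sub_nonneg.2 hs)
        linarith
      have hs1 : ‖y + (s' - s) • v‖ ≤ √(δ ^ 2 + ‖y + (s' - s) • v‖ ^ 2) :=
        Real.le_sqrt_of_sq_le (by nlinarith [sq_nonneg δ])
      have hs2 : √(δ ^ 2 + ‖y + (s' - s) • v‖ ^ 2) ^ 2 = δ ^ 2 + ‖y + (s' - s) • v‖ ^ 2 :=
        Real.sq_sqrt (by positivity)
      rw [Real.sqrt_le_iff]
      refine ⟨by positivity, ?_⟩
      have h4 := pow_le_pow_left₀ (norm_nonneg y) h3 2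
      have h5 := mul_le_mul_of_nonneg_right hs1 h0
      nlinarith
    rw [hy']
    nlinarith
  have hd : HasDerivAt (fun s : ℝ => coneWeight vmax c k δ (z + s • ((1, v) : ℝ × Space d)))
      (fderiv ℝ (coneWeight vmax c k δ) z (1, v)) 0 := by
    have h1 : HasFDerivAt (coneWeight vmax c k δ) (fderiv ℝ (coneWeight vmax c k δ) z)
        (z + (0 : ℝ) • ((1, v) : ℝ × Space d)) := by
      simpa using ((contDiff_coneWeight hδ).contDiffAt.differentiableAt (by simp)).hasFDerivAt
    have h2 : HasDerivAt (fun s : ℝ => z + s • ((1, v) : ℝ × Space d)) (1, v) 0 := by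
      simpa using ((hasDerivAt_id (0 : ℝ)).smul_const ((1, v) : ℝ × Space d)).const_add z
    exact h1.comp_hasDerivAt 0 h2
  rw [← hd.deriv]
  exact hanti.deriv_nonpos

end ConeWeight

/-- A continuous function times a function that is locally integrable up to the initial time is
integrable on a set if it vanishes there outside a compact subset of `[0, T) × ℝ^d`. -/
lemma integrableOn_mul_of_eq_zero {T : ℝ} {f ψ : ℝ × Space d → ℝ} {K S : Set (ℝ × Space d)}
    (hf : LocallyIntegrableOn f (Ico 0 T ×ˢ univ) volume) (hψ : Continuous ψ)
    (hK : IsCompact K) (hKT : K ⊆ Ico 0 T ×ˢ univ) (hS : MeasurableSet S)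
    (h0 : ∀ z ∈ S \ K, ψ z = 0) : IntegrableOn (fun z => ψ z * f z) S :=
  IntegrableOn.of_forall_sdiff_eq_zero
    ((hf.integrableOn_compact_subset hKT hK).continuousOn_mul hψ.continuousOn hK) hS
    fun z hz => by rw [h0 z hz, zero_mul]

/-- The amount of `cutEntropy` in the slice at time `t` of the cone of `coneWeight`. -/
def coneEntropy (h : ℝ → ℝ) (U : ℝ → Space d → State d) (vmax : ℝ) (c : Space d) (k δ s₀ t : ℝ) :
    ℝ := ∫ x, coneWeight vmax c k δ (t, x) * cutEntropy h s₀ (U t x)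

variable {T : ℝ} {U : ℝ → Space d → State d} {vmax : ℝ} {c : Space d} {k δ : ℝ}

/-- The entropy in the slices of a cone of speed `vmax` does not increase, in the sense of
distributions. -/
lemma coneEntropy_distributional (hd : 0 < d) (hh : IsSyngeEOS h) (hU : IsEntropySolution h T U)
    (hv : BoundsWaveSpeed h T U vmax) (hvmax : 0 ≤ vmax) (hδ : 0 < δ) (s₀ : ℝ) {a : ℝ → ℝ}
    (ha : ContDiff ℝ ∞ a) (ha0 : ∀ t, 0 ≤ a t)
    (hsupp : ∃ A, ∃ B < T, ∀ t, t ∉ Icc A B → a t = 0) :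
    0 ≤ (∫ t in Ioo 0 T, deriv a t * coneEntropy h U vmax c k δ s₀ t)
      + a 0 * coneEntropy h U vmax c k δ s₀ 0 := by
  obtain ⟨A, B, hBT, hAB⟩ := hsupp
  obtain ⟨hlocη, hlocq, hent⟩ := hU.entropy _ _ (isConvexEntropyPair_cutEntropy (d := d) hh s₀)
  set W : ℝ × Space d → ℝ := coneWeight vmax c k δ with hWdef
  have hW : ContDiff ℝ ∞ W := contDiff_coneWeight hδ
  let φ : ℝ × Space d → ℝ := fun z => a z.1 * W z
  have hφ : ContDiff ℝ ∞ φ := (ha.comp contDiff_fst).mul hW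
  let K₀ : Set (ℝ × Space d) := Icc A B ×ˢ Metric.closedBall c (k - vmax * A)
  have hK₀ : IsCompact K₀ := isCompact_Icc.prod (isCompact_closedBall _ _)
  have hW0 : ∀ z : ℝ × Space d, z.1 ∈ Icc A B → z ∉ K₀ → W z = 0 := by
    intro z hz hzK
    refine coneWeight_eq_zero ?_
    by_contra hc
    refine hzK ⟨hz, ?_⟩
    rw [Metric.mem_closedBall, dist_eq_norm]
    have := mul_le_mul_of_nonneg_left hz.1 hvmax
    linarith [not_le.1 hc]
  have hφ0 : ∀ z, z ∉ K₀ → φ z = 0 := by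
    intro z hz
    by_cases hz1 : z.1 ∈ Icc A B
    · simp only [φ]; rw [hW0 z hz1 hz, mul_zero]
    · simp only [φ]; rw [hAB _ hz1, zero_mul]
  have hts : tsupport φ ⊆ K₀ :=
    closure_minimal (fun z hz => by_contra fun hc => hz (hφ0 z hc)) hK₀.isClosed
  have htest : IsTestFunction T φ := by
    refine ⟨hφ, HasCompactSupport.intro hK₀ hφ0, hts.trans ?_⟩
    exact fun z hz => ⟨hz.1.2.trans_lt hBT, mem_univ _⟩
  have hineq := hent φ htest fun z => mul_nonneg (ha0 _) (coneWeight_nonneg _)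
  have hdφ0 : ∀ z, z ∉ K₀ → fderiv ℝ φ z = 0 := by
    intro z hz
    by_contra hc
    exact hz (hts (support_fderiv_subset ℝ hc))
  have hda0 : ∀ t, t ∉ Icc A B → deriv a t = 0 := by
    intro t ht
    have hts' : tsupport a ⊆ Icc A B :=
      closure_minimal (fun t ht => by_contra fun hc => ht (hAB t hc)) isClosed_Icc
    by_contra hc
    exact ht (hts' (support_deriv_subset hc))
  let K₁ : Set (ℝ × Space d) := Icc (max A 0) B ×ˢ Metric.closedBall c (k - vmax * A)
  have hK₁ : IsCompact K₁ := isCompact_Icc.prod (isCompact_closedBall _ _)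
  have hK₁T : K₁ ⊆ Ico 0 T ×ˢ univ := fun z hz =>
    ⟨⟨(le_max_right A 0).trans hz.1.1, hz.1.2.trans_lt hBT⟩, mem_univ _⟩
  have hstrip : MeasurableSet (strip d T) := measurableSet_Ioo.prod MeasurableSet.univ
  have hdiff : ∀ z ∈ strip d T \ K₁, z ∉ K₀ := fun z hz hz0 =>
    hz.2 ⟨⟨max_le hz0.1.1 (le_of_lt hz.1.1.1), hz0.1.2⟩, hz0.2⟩
  have hcd : ∀ w : ℝ × Space d, Continuous fun z => fderiv ℝ φ z w := fun w =>
    (hφ.continuous_fderiv (by simp)).clm_apply continuous_const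
  have hint1 : IntegrableOn (fun z : ℝ × Space d => dt φ z * cutEntropy h s₀ (U z.1 z.2)
      + ∑ i, dx i φ z * cutEntropyFlux h s₀ i (U z.1 z.2)) (strip d T) := by
    refine Integrable.add ?_ (integrable_finsetSum _ fun i _ => ?_)
    · exact integrableOn_mul_of_eq_zero hlocη.1 (hcd _) hK₁ hK₁T hstrip fun z hz => by
        rw [dt, hdφ0 z (hdiff z hz)]; rfl
    · exact integrableOn_mul_of_eq_zero (hlocq i) (hcd _) hK₁ hK₁T hstrip fun z hz => by
        rw [dx, hdφ0 z (hdiff z hz)]; rfl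
  have hint2 : IntegrableOn (fun z : ℝ × Space d => deriv a z.1 * W z * cutEntropy h s₀ (U z.1 z.2))
      (strip d T) := by
    refine integrableOn_mul_of_eq_zero (ψ := fun z => deriv a z.1 * W z) hlocη.1
      (((ha.continuous_deriv (by simp)).comp continuous_fst).mul hW.continuous) hK₁ hK₁T hstrip
      fun z hz => ?_
    by_cases hz1 : z.1 ∈ Icc A B
    · rw [hW0 z hz1 (hdiff z hz), mul_zero]
    · rw [hda0 _ hz1, zero_mul]
  have hfd : ∀ z w, fderiv ℝ φ z w = deriv a z.1 * w.1 * W z + a z.1 * fderiv ℝ W z w := by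
    intro z w
    have h1 : HasFDerivAt (fun z : ℝ × Space d => a z.1)
        (deriv a z.1 • ContinuousLinearMap.fst ℝ ℝ (Space d)) z :=
      ((ha.differentiable (by simp)).differentiableAt.hasDerivAt).comp_hasFDerivAt z hasFDerivAt_fst
    have h2 := (hW.differentiable (by simp) z).hasFDerivAt
    have h3 : fderiv ℝ φ z = _ := (h1.mul h2).fderiv
    rw [h3]
    simp
    ring
  have hle : ∫ z in strip d T, (dt φ z * cutEntropy h s₀ (U z.1 z.2)
      + ∑ i, dx i φ z * cutEntropyFlux h s₀ i (U z.1 z.2))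
      ≤ ∫ z in strip d T, deriv a z.1 * W z * cutEntropy h s₀ (U z.1 z.2) := by
    refine integral_mono_ae hint1 hint2 ?_
    filter_upwards [hU.mem, hv] with z hz hzv
    have hvel := (norm_velocity_le_of_forall_isCharSpeed hd hh hz hzv).1
    have hη := cutEntropy_nonneg (h := h) s₀ hz
    set v := velocity h (U z.1 z.2)
    have hsum : ∑ i, dx i φ z * cutEntropyFlux h s₀ i (U z.1 z.2)
        = a z.1 * fderiv ℝ W z (0, v) * cutEntropy h s₀ (U z.1 z.2) := by
      have hvs : ((0 : ℝ), v) = ∑ i, v i • ((0 : ℝ), EuclideanSpace.single i (1 : ℝ)) := by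
        refine Prod.ext ?_ ?_
        · simp [Prod.fst_sum]
        · simp only [Prod.snd_sum, Prod.smul_snd]
          ext j
          simp [Pi.single_apply]
      rw [hvs, map_sum, Finset.mul_sum, Finset.sum_mul]
      refine Finset.sum_congr rfl fun i _ => ?_
      rw [dx, hfd, map_smul, cutEntropyFlux, smul_eq_mul]
      ring
    have hadd : fderiv ℝ W z (1, v) = fderiv ℝ W z (1, 0) + fderiv ℝ W z (0, v) := by
      rw [← map_add]; simp
    have hneg : fderiv ℝ W z (1, v) ≤ 0 := fderiv_coneWeight_le hδ z hvel
    rw [hsum, dt, hfd]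
    have := mul_nonneg (mul_nonneg (ha0 z.1) hη) (neg_nonneg.2 hneg)
    rw [hadd] at this
    linarith
  have hfub : ∫ z in strip d T, deriv a z.1 * W z * cutEntropy h s₀ (U z.1 z.2)
      = ∫ t in Ioo 0 T, deriv a t * coneEntropy h U vmax c k δ s₀ t := by
    rw [Measure.volume_eq_prod, strip, setIntegral_prod]
    · refine setIntegral_congr_fun measurableSet_Ioo fun t _ => ?_
      simp only [Measure.restrict_univ, coneEntropy]
      rw [← integral_const_mul]
      exact integral_congr_ae (Eventually.of_forall fun x => by simp only [hWdef, mul_assoc])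
    · rw [← Measure.volume_eq_prod]
      exact hint2
  have hinit : ∫ x : Space d, φ (0, x) * cutEntropy h s₀ (U 0 x)
      = a 0 * coneEntropy h U vmax c k δ s₀ 0 := by
    rw [coneEntropy, ← integral_const_mul]
    exact integral_congr_ae (Eventually.of_forall fun x => by simp only [φ, hWdef, mul_assoc])
  rw [← hfub, ← hinit]
  linarith

lemma integrableOn_coneWeight_mul (hh : IsSyngeEOS h) (hU : IsEntropySolution h T U)
    (hvmax : 0 ≤ vmax) (hδ : 0 < δ) (s₀ : ℝ) {B : ℝ} (hB : B < T) :
    IntegrableOn (fun z : ℝ × Space d => coneWeight vmax c k δ z * cutEntropy h s₀ (U z.1 z.2))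
      (Ioo 0 B ×ˢ univ) := by
  obtain ⟨hlocη, -, -⟩ := hU.entropy _ _ (isConvexEntropyPair_cutEntropy (d := d) hh s₀)
  refine integrableOn_mul_of_eq_zero (K := Icc 0 B ×ˢ Metric.closedBall c k) hlocη.1
    (contDiff_coneWeight hδ).continuous (isCompact_Icc.prod (isCompact_closedBall _ _))
    (fun z hz => ⟨⟨hz.1.1, hz.1.2.trans_lt hB⟩, mem_univ _⟩)
    (measurableSet_Ioo.prod MeasurableSet.univ) fun z hz => coneWeight_eq_zero ?_
  by_contra hc
  refine hz.2 ⟨⟨hz.1.1.1.le, hz.1.1.2.le⟩, ?_⟩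
  rw [Metric.mem_closedBall, dist_eq_norm]
  have := mul_nonneg hvmax hz.1.1.1.le
  linarith [not_le.1 hc]

lemma integrableOn_coneEntropy (hh : IsSyngeEOS h) (hU : IsEntropySolution h T U)
    (hvmax : 0 ≤ vmax) (hδ : 0 < δ) (s₀ : ℝ) {B : ℝ} (hB : B < T) :
    IntegrableOn (coneEntropy h U vmax c k δ s₀) (Ioo 0 B) := by
  have hint := integrableOn_coneWeight_mul (c := c) (k := k) hh hU hvmax hδ s₀ hB
  rw [IntegrableOn, Measure.volume_eq_prod, ← Measure.prod_restrict, Measure.restrict_univ] at hint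
  exact hint.integral_prod_left

/-- The entropy in the cone does not increase, outside a null set of times. -/
lemma exists_null_coneEntropy_le (hd : 0 < d) (hh : IsSyngeEOS h) (hU : IsEntropySolution h T U)
    (hv : BoundsWaveSpeed h T U vmax) (hvmax : 0 ≤ vmax) (c : Space d) (k : ℝ) (hδ : 0 < δ)
    (s₀ : ℝ) :
    ∃ N : Set ℝ, volume N = 0 ∧ 0 ∉ N ∧ ∀ t₁ t₂ : ℝ, 0 ≤ t₁ → t₁ < t₂ → t₂ < T → t₁ ∉ N → t₂ ∉ N →
      coneEntropy h U vmax c k δ s₀ t₂ ≤ coneEntropy h U vmax c k δ s₀ t₁ :=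
  exists_null_forall_le_of_distributional
    (fun _ hB => integrableOn_coneEntropy hh hU hvmax hδ s₀ hB)
    fun _ ha ha0 hsupp => coneEntropy_distributional hd hh hU hv hvmax hδ s₀ ha ha0 hsupp

/-- In almost every time slice the weighted entropy is integrable. -/
lemma ae_integrable_coneWeight_mul (hh : IsSyngeEOS h) (hU : IsEntropySolution h T U)
    (hvmax : 0 ≤ vmax) (c : Space d) (k : ℝ) (hδ : 0 < δ) (s₀ : ℝ) :
    ∀ᵐ t : ℝ, t ∈ Ioo 0 T →
      Integrable fun x => coneWeight vmax c k δ (t, x) * cutEntropy h s₀ (U t x) := by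
  have h1 : ∀ m : ℕ, ∀ᵐ t : ℝ, t ∈ Ioo 0 (T - 1 / ((m : ℝ) + 1)) →
      Integrable fun x => coneWeight vmax c k δ (t, x) * cutEntropy h s₀ (U t x) := by
    intro m
    have hB : T - 1 / ((m : ℝ) + 1) < T := by
      have : (0 : ℝ) < 1 / ((m : ℝ) + 1) := by positivity
      linarith
    have hint := integrableOn_coneWeight_mul (c := c) (k := k) hh hU hvmax hδ s₀ hB
    rw [IntegrableOn, Measure.volume_eq_prod, ← Measure.prod_restrict, Measure.restrict_univ] at hint
    exact (ae_restrict_iff' measurableSet_Ioo).1 hint.prod_right_ae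
  filter_upwards [ae_all_iff.2 h1] with t ht htT
  obtain ⟨m, hm⟩ := exists_nat_one_div_lt (sub_pos.2 htT.2)
  exact ht m ⟨htT.1, by linarith⟩

/-- In almost every time slice the states are admissible almost everywhere. -/
lemma ae_slice_mem_admissible (hU : IsEntropySolution h T U) :
    ∀ᵐ t : ℝ, t ∈ Ioo 0 T → ∀ᵐ x, U t x ∈ admissible d h := by
  have h1 := hU.mem
  rw [strip, Measure.volume_eq_prod, ← Measure.prod_restrict, Measure.restrict_univ] at h1
  exact (ae_restrict_iff' measurableSet_Ioo).1 (Measure.ae_ae_of_ae_prod h1)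

end

end RelEuler

/-! ### The local minimum entropy principle -/

namespace RelEuler

noncomputable section

variable {d : ℕ} {h : ℝ → ℝ}

/-- At almost every point `x` of a set `A`, all small balls with centre near `x` relative to their
radius meet `A` in a set of positive measure. -/
lemma ae_eventually_forall_closedBall_pos (A : Set (Space d)) :
    ∀ᵐ x ∂(volume.restrict A), ∃ ε > 0, ∀ r, 0 < r → r < ε → ∀ y,
      x ∈ Metric.closedBall y (4 * r) → 0 < volume (A ∩ Metric.closedBall y r) := by
  filter_upwards [IsUnifLocDoublingMeasure.ae_tendsto_measure_inter_div
    (volume : Measure (Space d)) A 4] with x hx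
  let l : Filter (Space d × ℝ) :=
    comap Prod.snd (𝓝[>] (0 : ℝ)) ⊓ 𝓟 {p | x ∈ Metric.closedBall p.1 (4 * p.2)}
  have h1 := hx (l := l) Prod.fst Prod.snd (tendsto_comap.mono_left inf_le_left)
    (eventually_inf_principal.2 (Eventually.of_forall fun p hp => hp))
  have h2 := h1.eventually_const_lt (zero_lt_one (α := ENNReal))
  rw [eventually_inf_principal, eventually_comap] at h2
  obtain ⟨ε, hε, h3⟩ := (nhdsGT_basis (0 : ℝ)).eventually_iff.1 h2
  refine ⟨ε, hε, fun r hr0 hr y hy => ?_⟩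
  have h4 := h3 ⟨hr0, hr⟩ (y, r) rfl hy
  exact (ENNReal.div_pos_iff.1 h4).1.bot_lt

/-- If all balls of radius `r` with centre near `x` meet `A`, then the union of the balls of
radius `R` about the points of `A` contains a ball about `x` of radius larger than `R`. -/
lemma ball_subset_iUnion_ball {A : Set (Space d)} {x : Space d} {r R : ℝ} (hr : 0 < r) (hrR : r < R)
    (hA : ∀ y, x ∈ Metric.closedBall y (4 * r) → (A ∩ Metric.closedBall y r).Nonempty) :
    Metric.ball x (R + 2 * r) ⊆ ⋃ a ∈ A, Metric.ball a R := by
  intro z hz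
  rw [Metric.mem_ball] at hz
  simp only [mem_iUnion, Metric.mem_ball, exists_prop]
  by_cases hzx : dist z x ≤ 4 * r
  · obtain ⟨a, haA, ha⟩ := hA z (by rwa [Metric.mem_closedBall, dist_comm])
    refine ⟨a, haA, ?_⟩
    rw [Metric.mem_closedBall, dist_comm] at ha
    linarith
  · rw [not_le] at hzx
    have hpos : 0 < dist z x := by linarith
    -- the point of the segment from `x` to `z` at distance `4 r` from `x`
    obtain ⟨y, hy⟩ : ∃ y, y = AffineMap.lineMap x z (4 * r / dist z x) := ⟨_, rfl⟩
    have h1 : dist x y = 4 * r := by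
      rw [hy, dist_left_lineMap, Real.norm_of_nonneg (by positivity), dist_comm x z]
      field_simp
    have h2 : dist y z = dist z x - 4 * r := by
      rw [hy, dist_lineMap_right, Real.norm_of_nonneg, dist_comm x z]
      · field_simp
      · rw [sub_nonneg, div_le_one hpos]; exact hzx.le
    obtain ⟨a, haA, ha⟩ := hA y (by rw [Metric.mem_closedBall, h1])
    refine ⟨a, haA, ?_⟩
    rw [Metric.mem_closedBall] at ha
    have := dist_triangle z y a
    rw [dist_comm z y, h2, dist_comm y a] at this
    linarith

variable {T : ℝ} {U : ℝ → Space d → State d} {vmax : ℝ}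

/-- The local minimum entropy principle between two times from the monotonicity of the entropy in
a countable family of light cones. -/
theorem localMEP_of_coneEntropy_le (hvmax : 0 < vmax) {t₁ t₂ : ℝ} (h12 : t₁ < t₂)
    (hmem₁ : ∀ᵐ x, U t₁ x ∈ admissible d h) (hmem₂ : ∀ᵐ x, U t₂ x ∈ admissible d h)
    (hint : ∀ (n m : ℕ) (k s₀ : ℚ), Integrable fun x =>
      coneWeight vmax (TopologicalSpace.denseSeq (Space d) n) k (1 / ((m : ℝ) + 1)) (t₂, x)
        * cutEntropy h s₀ (U t₂ x))
    (hmono : ∀ (n m : ℕ) (k s₀ : ℚ),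
      coneEntropy h U vmax (TopologicalSpace.denseSeq (Space d) n) k (1 / ((m : ℝ) + 1)) s₀ t₂
        ≤ coneEntropy h U vmax (TopologicalSpace.denseSeq (Space d) n) k (1 / ((m : ℝ) + 1)) s₀ t₁) :
    LocalMEP h U vmax t₂ (t₂ - t₁) := by
  set R := (t₂ - t₁) * vmax with hR
  have hR0 : 0 < R := mul_pos (sub_pos.2 h12) hvmax
  let M : Space d → EReal := fun x =>
    essInf (fun z : Space d => ((specificEntropy h (U t₁ z) : ℝ) : EReal))
      (volume.restrict (Metric.closedBall x R))
  let A : ℚ → Set (Space d) := fun q =>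
    {x | specificEntropy h (U t₂ x) < q ∧ (((q : ℝ) : EReal)) < M x}
  suffices hA : ∀ q, volume (A q) = 0 by
    have hae : ∀ᵐ x : Space d, ∀ q, x ∉ A q :=
      ae_all_iff.2 fun q => measure_eq_zero_iff_ae_notMem.1 (hA q)
    filter_upwards [hae] with x hx
    rw [sub_sub_cancel]
    by_contra hc
    obtain ⟨q, hq1, hq2⟩ := EReal.lt_iff_exists_rat_btwn.1 (not_le.1 hc)
    exact hx q ⟨EReal.coe_lt_coe_iff.1 hq1, hq2⟩
  intro q
  by_contra hAq
  have hne : (ae (volume.restrict (A q))).NeBot :=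
    ae_neBot.2 fun h0 => hAq (Measure.restrict_eq_zero.1 h0)
  obtain ⟨x, ε, hε, hx⟩ := (ae_eventually_forall_closedBall_pos (A q)).exists
  obtain ⟨r, hr0, hr⟩ := exists_between (lt_min hε hR0)
  have hrε : r < ε := hr.trans_le (min_le_left _ _)
  have hrR : r < R := hr.trans_le (min_le_right _ _)
  have hsub : Metric.ball x (R + 2 * r) ⊆ ⋃ a ∈ A q, Metric.ball a R :=
    ball_subset_iUnion_ball hr0 hrR fun y hy =>
      nonempty_of_measure_ne_zero (hx r hr0 hrε y hy).ne'
  -- at the earlier time the entropy is at least `q` on a ball of radius larger than `R`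
  have hS₁ : ∀ᵐ z, z ∈ Metric.ball x (R + 2 * r) → (q : ℝ) ≤ specificEntropy h (U t₁ z) := by
    obtain ⟨C, hCA, hC, hCU⟩ := TopologicalSpace.isOpen_biUnion_countable (A q)
      (fun a => Metric.ball a R) fun a _ => Metric.isOpen_ball
    have h1 : ∀ a ∈ C, ∀ᵐ z, z ∈ Metric.ball a R → (q : ℝ) ≤ specificEntropy h (U t₁ z) := by
      intro a ha
      have h2 := (ae_restrict_iff' Metric.isClosed_closedBall.measurableSet).1
        (ae_lt_of_lt_essInf (hCA ha).2)
      filter_upwards [h2] with z hz hza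
      exact (EReal.coe_lt_coe_iff.1 (hz (Metric.ball_subset_closedBall hza))).le
    filter_upwards [(ae_ball_iff hC).2 h1] with z hz hzx
    have h3 := hsub hzx
    rw [← hCU] at h3
    simp only [mem_iUnion] at h3
    obtain ⟨a, haC, ha⟩ := h3
    exact hz a haC ha
  -- a cone from the family whose base lies in this ball and whose top contains a ball about `x`
  obtain ⟨n, hn⟩ : ∃ n, dist x (TopologicalSpace.denseSeq (Space d) n) < r / 4 :=
    (TopologicalSpace.denseRange_denseSeq (Space d)).exists_dist_lt x (by positivity)
  obtain ⟨m, hm⟩ := exists_nat_one_div_lt (show 0 < r / 4 by positivity)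
  obtain ⟨k, hk1, hk2⟩ := exists_rat_btwn (show vmax * t₁ + R + r < vmax * t₁ + R + 3 / 2 * r by linarith)
  have hδ : (0 : ℝ) < 1 / ((m : ℝ) + 1) := by positivity
  have hint := hint n m k q
  have hmono := hmono n m k q
  set c := TopologicalSpace.denseSeq (Space d) n
  have hzero : coneEntropy h U vmax c k (1 / ((m : ℝ) + 1)) q t₁ = 0 := by
    refine integral_eq_zero_of_ae ?_
    filter_upwards [hS₁, hmem₁] with z hz hza
    rw [Pi.zero_apply]
    by_cases hzx : z ∈ Metric.ball x (R + 2 * r)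
    · rw [(cutEntropy_eq_zero_iff hza).2 (hz hzx), mul_zero]
    · rw [coneWeight_eq_zero, zero_mul]
      rw [Metric.mem_ball, not_lt] at hzx
      have h1 := dist_triangle z c x
      rw [dist_comm c x] at h1
      rw [← dist_eq_norm]
      linarith
  rw [hzero] at hmono
  have hnn : 0 ≤ᵐ[volume] fun y =>
      coneWeight vmax c k (1 / ((m : ℝ) + 1)) (t₂, y) * cutEntropy h q (U t₂ y) := by
    filter_upwards [hmem₂] with y hy
    exact mul_nonneg (coneWeight_nonneg _) (cutEntropy_nonneg _ hy)
  have hae := (integral_eq_zero_iff_of_nonneg_ae hnn hint).1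
    (le_antisymm hmono (integral_nonneg_of_ae hnn))
  have hnull : volume (A q ∩ Metric.closedBall x (r / 2)) = 0 := by
    rw [measure_eq_zero_iff_ae_notMem]
    filter_upwards [hae, hmem₂] with y hy hya hyA
    have hW : 0 < coneWeight vmax c k (1 / ((m : ℝ) + 1)) (t₂, y) := by
      refine coneWeight_pos hδ ?_
      have h1 := dist_triangle y x c
      have h2 := hyA.2
      rw [Metric.mem_closedBall] at h2
      rw [← dist_eq_norm]
      have h3 : vmax * t₂ = vmax * t₁ + R := by rw [hR]; ring
      dsimp only
      linarith
    rw [Pi.zero_apply, mul_eq_zero, or_iff_right hW.ne', cutEntropy_eq_zero_iff hya] at hy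
    exact absurd hyA.1.1 (not_lt.2 hy)
  refine (hx (r / 2) (by positivity) (by linarith) x ?_).ne' hnull
  exact Metric.mem_closedBall_self (by positivity)

/-- A null set of times contains no right neighbourhood of a point. -/
lemma exists_seq_tendsto_nhdsGT_notMem {N : Set ℝ} (hN : volume N = 0) (t : ℝ) :
    ∃ s : ℕ → ℝ, Tendsto s atTop (𝓝[>] t) ∧ ∀ n, s n ∉ N := by
  have hne : (𝓝[>] t ⊓ 𝓟 Nᶜ).NeBot := by
    rw [← frequently_mem_iff_neBot]
    intro hev
    obtain ⟨b, hb, hsub⟩ := (nhdsGT_basis t).eventually_iff.1 hev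
    have h1 : Ioo t b ⊆ N := fun s hs => not_not.1 (hsub hs)
    have h2 := measure_mono_null h1 hN
    rw [Real.volume_Ioo, ENNReal.ofReal_eq_zero] at h2
    linarith
  obtain ⟨s, hs⟩ := exists_seq_tendsto (𝓝[>] t ⊓ 𝓟 Nᶜ)
  rw [tendsto_inf, tendsto_principal] at hs
  obtain ⟨n₀, hn₀⟩ := eventually_atTop.1 hs.2
  exact ⟨fun n => s (n + n₀), hs.1.comp (tendsto_add_atTop_nat n₀),
    fun n => hn₀ _ (Nat.le_add_left _ _)⟩

section TimeContinuous

lemma ae_mem_admissible_of_isTimeContinuous (hc : IsTimeContinuous h T U) {t : ℝ}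
    (ht : t ∈ Ico 0 T) : ∀ᵐ x, U t x ∈ admissible d h := by
  have h1 : ∀ n : ℕ, ∀ᵐ x, x ∈ Metric.ball (0 : Space d) n → U t x ∈ admissible d h := by
    intro n
    obtain ⟨K, -, hKG, hK⟩ := hc.compact t ht n
    filter_upwards [(ae_restrict_iff' measurableSet_ball).1 (hK t ⟨ht.1, le_rfl⟩)] with x hx hxn
    exact hKG (hx hxn)
  filter_upwards [ae_all_iff.2 h1] with x hx
  obtain ⟨n, hn⟩ := exists_nat_gt (dist x 0)
  exact hx n hn

/-- Locally in space-time the entropy is bounded, and its slices are measurable. -/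
lemma exists_bound_cutEntropy (hh : IsSyngeEOS h) (hc : IsTimeContinuous h T U) (s₀ : ℝ) {t₀ : ℝ}
    (ht₀ : t₀ ∈ Ico 0 T) (R : ℝ) : ∃ C : ℝ, ∀ t ∈ Icc 0 t₀,
      AEStronglyMeasurable (fun x => cutEntropy h s₀ (U t x))
        (volume.restrict (Metric.ball (0 : Space d) R)) ∧
      ∀ᵐ x ∂(volume.restrict (Metric.ball (0 : Space d) R)), ‖cutEntropy h s₀ (U t x)‖ ≤ C := by
  classical
  obtain ⟨K, hKc, hKG, hK⟩ := hc.compact t₀ ht₀ R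
  have hcont : ContinuousOn (cutEntropy h s₀) K := fun u hu =>
    (contDiffAt_cutEntropy hh s₀ (hKG hu)).continuousAt.continuousWithinAt
  obtain ⟨C, hC⟩ := hKc.exists_bound_of_continuousOn hcont
  refine ⟨C, fun t ht => ⟨?_, ?_⟩⟩
  · have hm : Measurable (K.piecewise (cutEntropy h s₀) 0) :=
      hcont.measurable_piecewise continuousOn_const hKc.measurableSet
    have hU : AEMeasurable (U t) (volume.restrict (Metric.ball (0 : Space d) R)) :=
      (hc.aesm t ⟨ht.1, ht.2.trans_lt ht₀.2⟩).aemeasurable.restrict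
    refine (hm.comp_aemeasurable hU).aestronglyMeasurable.congr ?_
    filter_upwards [hK t ht] with x hx
    exact piecewise_eq_of_mem _ _ _ hx
  · filter_upwards [hK t ht] with x hx using hC _ hx

variable {c : Space d} {k δ : ℝ}

lemma coneWeight_eq_zero_of_notMem_ball (hvmax : 0 ≤ vmax) {t : ℝ} (ht : 0 ≤ t) {x : Space d}
    (hx : x ∉ Metric.ball (0 : Space d) (‖c‖ + |k|)) : coneWeight vmax c k δ (t, x) = 0 := by
  refine coneWeight_eq_zero ?_
  rw [Metric.mem_ball, dist_zero_right, not_lt] at hx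
  have h1 := norm_sub_norm_le x c
  have h2 := mul_nonneg hvmax ht
  have h3 := le_abs_self k
  dsimp only
  linarith

lemma integrable_coneWeight_mul_of_isTimeContinuous (hh : IsSyngeEOS h)
    (hc : IsTimeContinuous h T U) (hvmax : 0 ≤ vmax) (hδ : 0 < δ) (s₀ : ℝ) {t : ℝ}
    (ht : t ∈ Ico 0 T) :
    Integrable fun x => coneWeight vmax c k δ (t, x) * cutEntropy h s₀ (U t x) := by
  obtain ⟨C, hC⟩ := exists_bound_cutEntropy hh hc s₀ ht (‖c‖ + |k|)
  obtain ⟨hm, hb⟩ := hC t ⟨ht.1, le_rfl⟩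
  have h1 : IntegrableOn (fun x => cutEntropy h s₀ (U t x)) (Metric.ball (0 : Space d) (‖c‖ + |k|)) :=
    IntegrableOn.of_bound measure_ball_lt_top hm C hb
  have h2 : IntegrableOn (fun x => coneWeight vmax c k δ (t, x) * cutEntropy h s₀ (U t x))
      (Metric.ball (0 : Space d) (‖c‖ + |k|)) := by
    refine Integrable.bdd_mul (c := 1) h1 ?_ (Eventually.of_forall fun x => ?_)
    · exact ((contDiff_coneWeight hδ).continuous.comp
        (continuous_const.prodMk continuous_id)).aestronglyMeasurable
    · rw [Real.norm_of_nonneg (coneWeight_nonneg _)]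
      exact Real.smoothTransition.le_one _
  rw [← integrableOn_univ]
  refine IntegrableOn.of_forall_sdiff_eq_zero h2 MeasurableSet.univ fun x hx => ?_
  rw [coneWeight_eq_zero_of_notMem_ball hvmax ht.1 hx.2, zero_mul]

/-- Any time is a limit of times outside a null set along which the entropy in a cone
converges. -/
lemma exists_seq_tendsto_coneEntropy (hh : IsSyngeEOS h)
    (hc : IsTimeContinuous h T U) (hvmax : 0 ≤ vmax) (hδ : 0 < δ) (s₀ : ℝ) {N : Set ℝ}
    (hN : volume N = 0) {t : ℝ} (ht : t ∈ Ico 0 T) :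
    ∃ s : ℕ → ℝ, Tendsto s atTop (𝓝[>] t) ∧ (∀ n, s n ∉ N) ∧
      Tendsto (fun n => coneEntropy h U vmax c k δ s₀ (s n)) atTop
        (𝓝 (coneEntropy h U vmax c k δ s₀ t)) := by
  set B := Metric.ball (0 : Space d) (‖c‖ + |k|) with hB
  obtain ⟨s, hs, hsN⟩ := exists_seq_tendsto_nhdsGT_notMem hN t
  obtain ⟨t₀, htt₀, ht₀T⟩ := exists_between ht.2
  have ht₀ : t₀ ∈ Ico 0 T := ⟨ht.1.trans htt₀.le, ht₀T⟩
  obtain ⟨n₀, hn₀⟩ := eventually_atTop.1 (hs.eventually (Ioo_mem_nhdsGT htt₀))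
  -- all times stay in `(t, t₀)` after dropping finitely many of them
  obtain ⟨s', hs'def⟩ : ∃ s' : ℕ → ℝ, s' = fun n => s (n + n₀) := ⟨_, rfl⟩
  have hs' : Tendsto s' atTop (𝓝[>] t) := by
    rw [hs'def]; exact hs.comp (tendsto_add_atTop_nat n₀)
  have hs'I : ∀ n, s' n ∈ Icc 0 t₀ := fun n => by
    have := hn₀ (n + n₀) (Nat.le_add_left _ _)
    rw [hs'def]
    exact ⟨ht.1.trans this.1.le, this.2.le⟩
  have hs'T : ∀ n, s' n ∈ Ico 0 T := fun n => ⟨(hs'I n).1, (hs'I n).2.trans_lt ht₀T⟩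
  have hs'N : ∀ n, s' n ∉ N := fun n => by rw [hs'def]; exact hsN _
  -- convergence in `L¹` of the ball, hence almost everywhere along a subsequence
  have hL1 : Tendsto (fun n => ∫⁻ x in B, ‖U (s' n) x - U t x‖ₑ) atTop (𝓝 0) := by
    refine (hc.continuous t ht (‖c‖ + |k|)).comp (tendsto_nhdsWithin_iff.2 ⟨?_, ?_⟩)
    · exact hs'.mono_right nhdsWithin_le_nhds
    · exact Eventually.of_forall hs'T
  have hmeas : TendstoInMeasure (volume.restrict B) (fun n => U (s' n)) atTop (U t) := by
    refine tendstoInMeasure_of_tendsto_eLpNorm one_ne_zero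
      (fun n => (hc.aesm _ (hs'T n)).restrict) (hc.aesm t ht).restrict ?_
    refine hL1.congr fun n => ?_
    rw [eLpNorm_one_eq_lintegral_enorm]
    rfl
  obtain ⟨ns, hns, hae⟩ := hmeas.exists_seq_tendsto_ae
  refine ⟨s' ∘ ns, hs'.comp hns.tendsto_atTop, fun n => hs'N _, ?_⟩
  have hset : ∀ r, 0 ≤ r → coneEntropy h U vmax c k δ s₀ r
      = ∫ x in B, coneWeight vmax c k δ (r, x) * cutEntropy h s₀ (U r x) := fun r hr =>
    (setIntegral_eq_integral_of_forall_compl_eq_zero fun x hx => by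
      rw [coneWeight_eq_zero_of_notMem_ball hvmax hr hx, zero_mul]).symm
  obtain ⟨C, hC⟩ := exists_bound_cutEntropy hh hc s₀ ht₀ (‖c‖ + |k|)
  rw [hset t ht.1]
  have hcW : Continuous (coneWeight vmax c k δ) := (contDiff_coneWeight hδ).continuous
  refine Tendsto.congr (fun n => (hset _ (hs'I (ns n)).1).symm) ?_
  refine tendsto_integral_of_dominated_convergence (fun _ => C) ?_ ?_ ?_ ?_
  · exact fun n => (hcW.comp (continuous_const.prodMk continuous_id)).aestronglyMeasurable.mul
      (hC _ (hs'I (ns n))).1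
  · exact integrableOn_const measure_ball_lt_top.ne
  · intro n
    filter_upwards [(hC _ (hs'I (ns n))).2] with x hx
    rw [norm_mul, Real.norm_of_nonneg (coneWeight_nonneg _)]
    refine le_trans ?_ hx
    exact mul_le_of_le_one_left (norm_nonneg _) (Real.smoothTransition.le_one _)
  · filter_upwards [hae, ae_restrict_of_ae (ae_mem_admissible_of_isTimeContinuous hc ht)] with x hx hxa
    refine Tendsto.mul ?_ ?_
    · refine (hcW.tendsto (t, x)).comp (Tendsto.prodMk_nhds ?_ tendsto_const_nhds)
      exact (hs'.mono_right nhdsWithin_le_nhds).comp hns.tendsto_atTop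
    · exact (contDiffAt_cutEntropy hh s₀ hxa).continuousAt.tendsto.comp hx

lemma coneEntropy_le_of_isTimeContinuous (hd : 0 < d) (hh : IsSyngeEOS h)
    (hU : IsEntropySolution h T U) (hv : BoundsWaveSpeed h T U vmax)
    (hc : IsTimeContinuous h T U) (hvmax : 0 ≤ vmax) (hδ : 0 < δ) (s₀ : ℝ) {t₁ t₂ : ℝ}
    (h1 : 0 ≤ t₁) (h12 : t₁ < t₂) (h2 : t₂ < T) :
    coneEntropy h U vmax c k δ s₀ t₂ ≤ coneEntropy h U vmax c k δ s₀ t₁ := by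
  obtain ⟨N, hN, -, hle⟩ := exists_null_coneEntropy_le hd hh hU hv hvmax c k hδ s₀
  obtain ⟨s, hs, hsN, hsl⟩ := exists_seq_tendsto_coneEntropy (c := c) (k := k) hh hc hvmax hδ s₀ hN
    (t := t₁) ⟨h1, h12.trans h2⟩
  obtain ⟨r, hr, hrN, hrl⟩ := exists_seq_tendsto_coneEntropy (c := c) (k := k) hh hc hvmax hδ s₀ hN
    (t := t₂) ⟨h1.trans h12.le, h2⟩
  refine le_of_tendsto_of_tendsto hrl hsl ?_
  filter_upwards [hs.eventually (Ioo_mem_nhdsGT h12), hr.eventually (Ioo_mem_nhdsGT h2)] with n hn hn'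
  exact hle _ _ (h1.trans hn.1.le) (hn.2.trans hn'.1) hn'.2 (hsN n) (hrN n)

end TimeContinuous

end

end RelEuler

theorem theorem2p3 {d : ℕ} (hd : 0 < d) (h : ℝ → ℝ) (hh : RelEuler.IsSyngeEOS h)
    (T : ℝ) (U : ℝ → RelEuler.Space d → RelEuler.State d)
    (hU : RelEuler.IsEntropySolution h T U)
    (vmax : ℝ) (hv : RelEuler.BoundsWaveSpeed h T U vmax) :
    (∃ N : Set ℝ, volume N = 0 ∧ 0 ∉ N ∧
      ∀ t τ : ℝ, 0 < τ → τ ≤ t → t < T → t ∉ N → t - τ ∉ N →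
        RelEuler.LocalMEP h U vmax t τ) ∧
    (RelEuler.IsTimeContinuous h T U →
      ∀ t τ : ℝ, 0 < τ → τ ≤ t → t < T → RelEuler.LocalMEP h U vmax t τ) := by
  rcases le_or_gt T 0 with hT | hT
  · exact ⟨⟨∅, measure_empty, notMem_empty 0, fun t τ h1 h2 h3 => by linarith⟩,
      fun _ t τ h1 h2 h3 => by linarith⟩
  have hvmax : 0 < vmax := by
    have hne : (ae (volume.restrict (RelEuler.strip d T))).NeBot := by
      refine ae_neBot.2 fun h0 => ?_
      have hopen : IsOpen (RelEuler.strip d T) := isOpen_Ioo.prod isOpen_univ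
      refine (hopen.measure_pos volume ⟨(T / 2, 0), ⟨by positivity, by linarith⟩, mem_univ _⟩).ne' ?_
      exact Measure.restrict_eq_zero.1 h0
    obtain ⟨z, hz, hzv⟩ := (hU.mem.and hv).exists
    exact (RelEuler.norm_velocity_le_of_forall_isCharSpeed hd hh hz hzv).2
  have hδ : ∀ m : ℕ, (0 : ℝ) < 1 / ((m : ℝ) + 1) := fun m => by positivity
  constructor
  · have hex : ∀ i : ℕ × ℕ × ℚ × ℚ, _ := fun i =>
      RelEuler.exists_null_coneEntropy_le hd hh hU hv hvmax.le
        (TopologicalSpace.denseSeq (RelEuler.Space d) i.1) i.2.2.1 (hδ i.2.1) i.2.2.2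
    choose N hN0 hN1 hN using hex
    have hint := ae_all_iff.2 fun i : ℕ × ℕ × ℚ × ℚ =>
      RelEuler.ae_integrable_coneWeight_mul hh hU hvmax.le
        (TopologicalSpace.denseSeq (RelEuler.Space d) i.1) i.2.2.1 (hδ i.2.1) i.2.2.2
    have hmem := RelEuler.ae_slice_mem_admissible hU
    obtain ⟨N', hN'⟩ : ∃ N' : Set ℝ, N' = {t | ¬ ((∀ i : ℕ × ℕ × ℚ × ℚ, t ∈ Ioo 0 T →
        Integrable fun x => RelEuler.coneWeight vmax
          (TopologicalSpace.denseSeq (RelEuler.Space d) i.1) i.2.2.1 (1 / ((i.2.1 : ℝ) + 1)) (t, x)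
          * RelEuler.cutEntropy h i.2.2.2 (U t x)) ∧
        (t ∈ Ioo 0 T → ∀ᵐ x, U t x ∈ RelEuler.admissible d h))} := ⟨_, rfl⟩
    have hN'0 : volume N' = 0 := by rw [hN']; exact ae_iff.1 (hint.and hmem)
    refine ⟨(⋃ i, N i) ∪ N', ?_, ?_, ?_⟩
    · exact measure_union_null (measure_iUnion_null hN0) hN'0
    · rw [mem_union, mem_iUnion, hN']
      rintro (⟨i, hi⟩ | h0)
      · exact hN1 i hi
      · exact h0 ⟨fun _ h1 => absurd h1.1 (lt_irrefl _), fun h1 => absurd h1.1 (lt_irrefl _)⟩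
    · intro t τ hτ hτt htT htN hsN
      rw [mem_union, not_or, mem_iUnion, not_exists] at htN hsN
      have ht0 : t ∈ Ioo 0 T := ⟨hτ.trans_le hτt, htT⟩
      have htG := htN.2
      have hsG := hsN.2
      rw [hN', mem_ofPred_eq, not_not] at htG hsG
      have hs : ∀ᵐ x, U (t - τ) x ∈ RelEuler.admissible d h := by
        rcases hτt.eq_or_lt with rfl | hlt
        · rw [sub_self]; exact hU.mem_init
        · exact hsG.2 ⟨by linarith, by linarith⟩
      have := RelEuler.localMEP_of_coneEntropy_le (h := h) (U := U) hvmax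
        (show t - τ < t by linarith) hs (htG.2 ht0)
        (fun n m k s₀ => htG.1 (n, m, k, s₀) ht0)
        fun n m k s₀ => hN (n, m, k, s₀) _ _ (by linarith) (by linarith) htT
          (hsN.1 _) (htN.1 _)
      rwa [sub_sub_cancel] at this
  · intro hc t τ hτ hτt htT
    have := RelEuler.localMEP_of_coneEntropy_le (h := h) (U := U) hvmax
      (show t - τ < t by linarith)
      (RelEuler.ae_mem_admissible_of_isTimeContinuous hc ⟨by linarith, by linarith⟩)
      (RelEuler.ae_mem_admissible_of_isTimeContinuous hc ⟨by linarith, htT⟩)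
      (fun n m k s₀ => RelEuler.integrable_coneWeight_mul_of_isTimeContinuous hh hc hvmax.le
        (hδ m) s₀ ⟨by linarith, htT⟩)
      fun n m k s₀ => RelEuler.coneEntropy_le_of_isTimeContinuous hd hh hU hv hc hvmax.le (hδ m) s₀
        (by linarith) (by linarith) htT
    rwa [sub_sub_cancel] at this
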